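/- For $r\ge 0$ let $H^2_r$ be the real Hilbert space of functions $f(z)=\sum_{n\ge 0}f_nz^n$, analytic in the unit disc $\mathbb{D}$, with $f_n\in\mathbb{R}$ and $\|f\|_{H^2_r}^2=\sum_{n\ge 0}(1+n)^{2r}|f_n|^2<\infty$. Functions in $H^2_{3/4}$ are continuous on the closed disc; let $\mathring H^2_{3/4}=\{f\in H^2_{3/4}: f(1)=0\}$, with the norm of $H^2_{3/4}$. All square roots are principal. For $F\in L^1(\mathbb{T})$, where $\mathbb{T}$ is the unit circle, and $z\in\mathbb{D}$, put $(P_+F)(z)=\frac{1}{2\pi i}\int_{|\zeta|=1}\frac{F(\zeta)\,d\zeta}{\zeta-z}$, and define $$(\mathcal{A}f)(z)=P_+\Bigl[\frac{f(\zeta)}{\sqrt{-\zeta}}\Bigr](z),\qquad z\in\mathbb{D}.$$ Let $$\mathcal{H}=\Bigl\{h=\{h_n\}_{n\ge 0}\subset\mathbb{R}:\ \sum_{n\ge 0}h_nz^n\equiv\frac{f(z)}{\sqrt{1-z}}\ \text{in }\mathbb{D}\text{ for some } f\in H^2_{3/4}\Bigr\},\qquad \|h\|_{\mathcal{H}}=\|f\|_{H^2_{3/4}}$$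 ($f$ is determined by $h$), and let $\mathcal{H}_0\subset\mathcal{H}$ be the subspace of those $h$ for which $f(1)=0$. Then: (i) $\mathcal{A}$ maps $\mathring H^2_{3/4}$ bijectively onto $H^2_{3/4}$, and both $\mathcal{A}:\mathring H^2_{3/4}\to H^2_{3/4}$ and its inverse are bounded. (ii) For every $g\in H^2_{3/4}$ the function $g(\zeta)/\sqrt{1-\overline{\zeta}}$ is integrable on $\mathbb{T}$ and its image under $P_+$ is the generating function $\sum_{n\ge 0} h_nz^n$ of a real sequence $h$. Moreover, $$\mathcal{H}_0=\Bigl\{\{h_n\}_{n\ge 0}\subset\mathbb{R}:\ \sum_{n\ge 0}h_nz^n\equiv P_+\Bigl[\frac{g(\zeta)}{\sqrt{1-\overline{\zeta}}}\Bigr](z)\ \text{in }\mathbb{D}\text{ for some } g\in H^2_{3/4}\Bigr\},$$ and there are absolute constants $C_1,C_2>0$ such that $C_1\|g\|_{H^2_{3/4}}\le\|h\|_{\mathcal{H}}\le C_2\|g\|_{H^2_{3/4}}$ for every $g\in H^2_{3/4}$ and the corresponding sequence $h$. -/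

import Mathlib

open scoped ComplexConjugate

noncomputable section

theorem memlp_weight_iff (r : ℝ) (c : ℕ → ℝ) :
    Memℓp (fun n : ℕ => (1 + (n : ℝ)) ^ r * c n) 2 ↔
      Summable (fun n : ℕ => (1 + (n : ℝ)) ^ (2 * r) * |c n| ^ 2) := by
  rw [memℓp_gen_iff (by norm_num)]
  refine summable_congr fun n => ?_
  have h : (0 : ℝ) ≤ 1 + (n : ℝ) := by positivity
  simp only [ENNReal.toReal_ofNat, Real.rpow_two, norm_mul, mul_pow, Real.norm_eq_abs, sq_abs]
  rw [← Real.rpow_two, ← Real.rpow_mul h, mul_comm r 2]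

/-- The real weighted space `ℓ²_r` of all real sequences `c` with
`∑ (1 + n) ^ (2 r) |c n| ^ 2 < ∞`. -/
def weightedL2 (r : ℝ) : Submodule ℝ (ℕ → ℝ) where
  carrier := {c | Summable (fun n : ℕ => (1 + (n : ℝ)) ^ (2 * r) * |c n| ^ 2)}
  zero_mem' := by simp [summable_zero]
  add_mem' := by
    intro a b ha hb
    rw [Set.mem_ofPred_eq, ← memlp_weight_iff] at *
    convert ha.add hb using 1
    ext n
    simp [mul_add]
  smul_mem' := by
    intro k a ha
    rw [Set.mem_ofPred_eq, ← memlp_weight_iff] at *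
    convert ha.const_smul k using 1
    ext n
    simp [mul_left_comm]

/-- The Hardy–Sobolev space `H²_r` of the unit disc: the analytic functions
`f(z) = ∑ fₙ zⁿ` with real coefficients such that `(fₙ) ∈ ℓ²_r`. An element is stored
through its sequence of Taylor coefficients; its values are given by `HardySobolev.eval`. The type
is not a reducible synonym, so that it does not inherit the topology of
pointwise convergence of the coefficients. -/
def HardySobolev (r : ℝ) : Type := ↥(weightedL2 r)

namespace HardySobolev

variable {r : ℝ}

instance : AddCommGroup (HardySobolev r) := inferInstanceAs (AddCommGroup ↥(weightedL2 r))

instance : Module ℝ (HardySobolev r) := inferInstanceAs (Module ℝ ↥(weightedL2 r))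

/-- The Taylor coefficients `fₙ` of `f`. -/
def coeff (f : HardySobolev r) : ℕ → ℝ := f.1

theorem coeff_injective : Function.Injective (coeff (r := r)) := fun _ _ h => Subtype.ext h

theorem summable_coeff (f : HardySobolev r) :
    Summable (fun n : ℕ => (1 + (n : ℝ)) ^ (2 * r) * |f.coeff n| ^ 2) := f.2

@[simp] theorem coeff_zero : (0 : HardySobolev r).coeff = 0 := rfl

@[simp] theorem coeff_add (f g : HardySobolev r) : (f + g).coeff = f.coeff + g.coeff := rfl

@[simp] theorem coeff_smul (k : ℝ) (f : HardySobolev r) : (k • f).coeff = k • f.coeff := rfl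

/-- The sequence `((1 + n) ^ r fₙ)` as an element of the unweighted `ℓ²`. -/
def toL2 : HardySobolev r →ₗ[ℝ] lp (fun _ : ℕ => ℝ) 2 where
  toFun f := ⟨fun n => (1 + (n : ℝ)) ^ r * f.coeff n, (memlp_weight_iff r f.coeff).2 f.2⟩
  map_add' f g := by ext n; exact mul_add _ _ _
  map_smul' k f := by ext n; exact mul_left_comm _ _ _

theorem toL2_injective : Function.Injective (toL2 (r := r)) := by
  intro f g h
  apply coeff_injective
  ext n
  have h1 : (1 + (n : ℝ)) ^ r * f.coeff n = (1 + (n : ℝ)) ^ r * g.coeff n :=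
    congrFun (congrArg Subtype.val h) n
  have h2 : (0 : ℝ) < (1 + (n : ℝ)) ^ r := Real.rpow_pos_of_pos (by positivity) r
  exact mul_left_cancel₀ h2.ne' h1

instance : NormedAddCommGroup (HardySobolev r) :=
  NormedAddCommGroup.induced (HardySobolev r) (lp (fun _ : ℕ => ℝ) 2) toL2 toL2_injective

instance : NormedSpace ℝ (HardySobolev r) :=
  NormedSpace.induced ℝ (HardySobolev r) (lp (fun _ : ℕ => ℝ) 2) toL2

/-- The norm of `H²_r` is the norm of `ℓ²_r` of the coefficients. -/
theorem norm_eq (f : HardySobolev r) :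
    ‖f‖ = Real.sqrt (∑' n : ℕ, (1 + (n : ℝ)) ^ (2 * r) * |f.coeff n| ^ 2) := by
  have h0 : ‖f‖ = ‖toL2 f‖ := rfl
  rw [h0, lp.norm_eq_tsum_rpow (by norm_num), Real.sqrt_eq_rpow]
  simp only [ENNReal.toReal_ofNat]
  congr 1
  refine tsum_congr fun n => ?_
  have h : (0 : ℝ) ≤ 1 + (n : ℝ) := by positivity
  have h1 : (toL2 f : ℕ → ℝ) n = (1 + (n : ℝ)) ^ r * f.coeff n := rfl
  rw [h1, Real.rpow_two, norm_mul, mul_pow, Real.norm_eq_abs, Real.norm_eq_abs, sq_abs,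
    ← Real.rpow_two, ← Real.rpow_mul h, mul_comm r 2]

/-- The value `f(z) = ∑ fₙ zⁿ`. The series converges for `|z| < 1` and, when `r > 1/2`,
absolutely and uniformly for `|z| ≤ 1`, so that it also gives the boundary values. -/
def eval (f : HardySobolev r) (z : ℂ) : ℂ := ∑' n : ℕ, (f.coeff n : ℂ) * z ^ n

theorem summable_abs_coeff (hr : 1 / 2 < r) (f : HardySobolev r) :
    Summable (fun n => |f.coeff n|) := by
  have h1 : Summable (fun n : ℕ => (1 + (n : ℝ)) ^ (-(2 * r))) := by
    have := (summable_nat_add_iff 1).2 (Real.summable_nat_rpow.2 (by linarith : -(2 * r) < -1))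
    refine this.congr fun n => ?_
    push_cast
    rw [add_comm]
  refine Summable.of_nonneg_of_le (fun _ => abs_nonneg _) (fun n => ?_) (h1.add f.summable_coeff)
  have hp : (0 : ℝ) < 1 + (n : ℝ) := by positivity
  set x : ℝ := (1 + (n : ℝ)) ^ r with hx
  have hx0 : 0 < x := Real.rpow_pos_of_pos hp r
  have e1 : (1 + (n : ℝ)) ^ (2 * r) = x ^ 2 := by
    rw [hx, ← Real.rpow_two, ← Real.rpow_mul hp.le, mul_comm]
  rw [Real.rpow_neg hp.le, e1, ← mul_pow, ← inv_pow]
  have e2 : |f.coeff n| = x⁻¹ * (x * |f.coeff n|) := by field_simp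
  have e3 : 0 ≤ x⁻¹ := by positivity
  have e4 : 0 ≤ x * |f.coeff n| := by positivity
  nlinarith [sq_nonneg (x⁻¹ - x * |f.coeff n|)]

theorem hasSum_eval (hr : 1 / 2 < r) (f : HardySobolev r) {z : ℂ} (hz : ‖z‖ ≤ 1) :
    HasSum (fun n : ℕ => (f.coeff n : ℂ) * z ^ n) (f.eval z) := by
  refine Summable.hasSum (Summable.of_norm_bounded (f.summable_abs_coeff hr) fun n => ?_)
  rw [norm_mul, norm_pow, Complex.norm_real, Real.norm_eq_abs]
  exact mul_le_of_le_one_right (abs_nonneg _) (pow_le_one₀ (norm_nonneg _) hz)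

end HardySobolev

/-- The closed subspace of all `f ∈ H²_{3/4}` with `f(1) = 0`. -/
def HardySobolevVanish : Submodule ℝ (HardySobolev (3 / 4)) where
  carrier := {f | f.eval 1 = 0}
  zero_mem' := by simp [HardySobolev.eval]
  add_mem' := by
    intro f g hf hg
    have h1 := f.hasSum_eval (by norm_num) (z := 1) (by simp)
    have h2 := g.hasSum_eval (by norm_num) (z := 1) (by simp)
    have h3 := (f + g).hasSum_eval (by norm_num) (z := 1) (by simp)
    have h4 := h1.add h2
    rw [Set.mem_ofPred_eq] at *
    rw [hf, hg, add_zero] at h4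
    refine h3.unique (h4.congr_fun ?_)
    intro n
    simp
  smul_mem' := by
    intro k f hf
    have h1 := f.hasSum_eval (by norm_num) (z := 1) (by simp)
    have h3 := (k • f).hasSum_eval (by norm_num) (z := 1) (by simp)
    have h4 := h1.mul_left (k : ℂ)
    rw [Set.mem_ofPred_eq] at *
    rw [hf, mul_zero] at h4
    refine h3.unique (h4.congr_fun ?_)
    intro n
    simp

/-- The Riesz projection `(P₊ F)(z) = (1 / 2πi) ∮_{|ζ| = 1} F(ζ) / (ζ - z) dζ`, for `F`
integrable on the unit circle and `|z| < 1`. -/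
def rieszProj (F : ℂ → ℂ) (z : ℂ) : ℂ :=
  (2 * (Real.pi : ℂ) * Complex.I)⁻¹ * ∮ ζ in C(0, 1), F ζ / (ζ - z)

/-- The operator `(𝒜 F)(z) = P₊[F(ζ) / √(-ζ)](z)`, with the principal branch
`√(e ^ (i φ)) = e ^ (i φ / 2)`, `φ ∈ (-π, π)`. -/
def opA (F : ℂ → ℂ) : ℂ → ℂ := rieszProj fun ζ => F ζ / Complex.sqrt (-ζ)

/-- `∑ hₙ zⁿ` converges to `Φ(z)` at each point `z` of the open unit disc. -/
def IsGenFun (h : ℕ → ℝ) (Φ : ℂ → ℂ) : Prop :=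
  ∀ z ∈ Metric.ball (0 : ℂ) 1, HasSum (fun n : ℕ => (h n : ℂ) * z ^ n) (Φ z)

/-- `∑ hₙ zⁿ ≡ f(z) / √(1 - z)` in the unit disc. -/
def RepresentsH (f : HardySobolev (3 / 4)) (h : ℕ → ℝ) : Prop :=
  IsGenFun h fun z => f.eval z / Complex.sqrt (1 - z)

/-- The space `ℋ` of spectral data. -/
def spaceH : Set (ℕ → ℝ) := {h | ∃ f, RepresentsH f h}

/-- The norm `‖h‖_ℋ = ‖f‖_{H²_{3/4}}`, where `f` is the (unique) element of `H²_{3/4}` which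
represents `h ∈ ℋ`; see `normH_eq`. -/
def normH (h : ℕ → ℝ) : ℝ := ⨅ f : {f // RepresentsH f h}, ‖f.1‖

/-- The subspace `ℋ₀` of `ℋ`. -/
def spaceH0 : Set (ℕ → ℝ) := {h | ∃ f, RepresentsH f h ∧ f.eval 1 = 0}

/-- The function `P₊[g(ζ) / √(1 - ζ̄)]` on the unit disc. -/
def dualRep (g : HardySobolev (3 / 4)) : ℂ → ℂ :=
  rieszProj fun ζ => g.eval ζ / Complex.sqrt (1 - conj ζ)

/-- The coefficients of a power series are determined by its sum. -/
theorem IsGenFun.unique {a b : ℕ → ℝ} {Φ : ℂ → ℂ} (ha : IsGenFun a Φ) (hb : IsGenFun b Φ) :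
    a = b := by
  have key : ∀ c : ℕ → ℝ, IsGenFun c Φ →
      HasFPowerSeriesAt Φ (FormalMultilinearSeries.ofScalars ℂ (fun n => (c n : ℂ))) 0 := by
    intro c hc
    rw [hasFPowerSeriesAt_iff]
    filter_upwards [Metric.ball_mem_nhds (0 : ℂ) one_pos] with z hz
    simpa [FormalMultilinearSeries.coeff_ofScalars, mul_comm] using hc z hz
  have h := (key a ha).eq_formalMultilinearSeries (key b hb)
  ext n
  have := congrArg (fun p => FormalMultilinearSeries.coeff p n) h
  simpa [FormalMultilinearSeries.coeff_ofScalars] using this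

theorem RepresentsH.unique {f₁ f₂ : HardySobolev (3 / 4)} {h : ℕ → ℝ}
    (h₁ : RepresentsH f₁ h) (h₂ : RepresentsH f₂ h) : f₁ = f₂ := by
  apply HardySobolev.coeff_injective
  have e : ∀ z ∈ Metric.ball (0 : ℂ) 1, f₁.eval z = f₂.eval z := by
    intro z hz
    have hz' : 1 - z ≠ 0 := by
      intro h0
      have : z = 1 := (sub_eq_zero.1 h0).symm
      simp [this] at hz
    have hs : Complex.sqrt (1 - z) ≠ 0 := by simp [Complex.sqrt, Complex.cpow_eq_zero_iff, hz']
    exact (div_left_inj' hs).1 ((h₁ z hz).unique (h₂ z hz))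
  have g : ∀ f : HardySobolev (3 / 4), IsGenFun f.coeff f.eval := fun f z hz =>
    f.hasSum_eval (by norm_num) (by simpa using (mem_ball_zero_iff.1 hz).le)
  refine (g f₁).unique (Φ := f₁.eval) fun z hz => ?_
  rw [e z hz]
  exact g f₂ z hz

theorem normH_eq {f : HardySobolev (3 / 4)} {h : ℕ → ℝ} (hf : RepresentsH f h) :
    normH h = ‖f‖ := by
  have : Unique {f // RepresentsH f h} := ⟨⟨⟨f, hf⟩⟩, fun g => Subtype.ext (g.2.unique hf)⟩
  rw [normH, ciInf_unique]
  exact congrArg _ ((default : {f // RepresentsH f h}).2.unique hf)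

end

noncomputable section

open Filter Topology Finset

/-! On the unit circle `(1 - ζ̄) / (1 - ζ) = -ζ̄`, whence `1 / √(-ζ) = √(1 - ζ̄) · (1 / √(1 - ζ))`.
This Wiener–Hopf factorization of the symbol of the Toeplitz operator `𝒜` suggests the inverse `g ↦
√(1 - z) P₊[g / √(1 - ζ̄)]`. Thus `f = 𝒜⁻¹ g` says exactly that `f / √(1 - z) = P₊[g / √(1 - ζ̄)]`,
and (ii) follows from (i). Everything is carried out on Taylor coefficients, where `𝒜` has the
matrix `1 / (π (n - m + 1/2))`; the factorization is `hasSum_sqrtCoeff_mul_invSqrtCoeffInt`.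

Boundedness: since `(n + 1/2) / (n - m + 1/2) = 1 + m / (n - m + 1/2)`, one has `(n + 1/2) π (𝒜f)ₙ =
f(1) + ∑ m fₘ / (n - m + 1/2)`. When `f(1) = 0`, it remains to bound the Hilbert matrix on `ℓ²` with
weight `(1 + n) ^ (-1/4)`. Without weight it is bounded because its symbol is unimodular; the
weights change it by a matrix that passes Schur's test (`abs_sum_weightedHilbert_le`). The matrix of
the inverse has a closed form (`sum_range_sqrtCoeff_mul_invSqrtCoeffInt`) which reduces to the
transposed weighted matrix.

Bijectivity: the factorization makes the candidate a right inverse. Its values vanish at `1`, since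
otherwise the constant `f(1)` in the identity above would be square summable against `(1 + n) ^
(-1/4)` (`tsum_coeff_inverseA`). Injectivity is a maximum principle: the coefficients of `√(1 - z)`
after the leading `1` are nonpositive with sum `-1`. -/

/-! ### Taylor coefficients of `(1 - z) ^ (±1/2)` -/

/-- The Taylor coefficients of `(1 - z) ^ (-1/2)`. -/
def invSqrtCoeff (n : ℕ) : ℝ := (n.centralBinom : ℝ) / 4 ^ n

/-- The Taylor coefficients of `(1 - z) ^ (1/2)`. -/
def sqrtCoeff (n : ℕ) : ℝ := invSqrtCoeff n / (1 - 2 * n)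

/-- The Taylor coefficients of `(1 - z) ^ (-1/2)`, extended by zero to negative indices. -/
def invSqrtCoeffInt (k : ℤ) : ℝ := if 0 ≤ k then invSqrtCoeff k.toNat else 0

theorem invSqrtCoeff_zero : invSqrtCoeff 0 = 1 := by simp [invSqrtCoeff]

theorem invSqrtCoeff_succ (n : ℕ) :
    invSqrtCoeff (n + 1) = invSqrtCoeff n * ((2 * n + 1) / (2 * n + 2)) := by
  have h := Nat.succ_mul_centralBinom_succ n
  have h' : ((n : ℝ) + 1) * (n + 1).centralBinom = 2 * (2 * n + 1) * n.centralBinom := by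
    exact_mod_cast h
  have h1 : ((n + 1).centralBinom : ℝ) = 2 * (2 * n + 1) * n.centralBinom / (n + 1) := by
    field_simp
    linarith
  simp only [invSqrtCoeff, h1, pow_succ]
  field_simp
  ring

theorem invSqrtCoeff_pos (n : ℕ) : 0 < invSqrtCoeff n := by
  have := n.centralBinom_pos
  unfold invSqrtCoeff
  positivity

/-- The left side decreases, its successive ratios being `(2n + 1)(2n + 3) / (2n + 2)² < 1`. This is
the upper bound of order `n ^ (-1/2)` used in all norm estimates. -/
theorem invSqrtCoeff_sq_mul_le (n : ℕ) : invSqrtCoeff n ^ 2 * (2 * n + 1) ≤ 1 := by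
  induction n with
  | zero => simp [invSqrtCoeff_zero]
  | succ n ih =>
    refine le_trans ?_ ih
    rw [invSqrtCoeff_succ, mul_pow, mul_assoc]
    refine mul_le_mul_of_nonneg_left ?_ (sq_nonneg _)
    push_cast
    rw [div_pow, div_mul_eq_mul_div, div_le_iff₀ (by positivity)]
    nlinarith

theorem invSqrtCoeff_le_one (n : ℕ) : invSqrtCoeff n ≤ 1 := by
  have := invSqrtCoeff_sq_mul_le n
  have h := invSqrtCoeff_pos n
  have hn : (0 : ℝ) ≤ n := n.cast_nonneg
  nlinarith [mul_nonneg (sq_nonneg (invSqrtCoeff n)) hn]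

/-- Both sequences have the same step factor up to inversion; Wallis' product then supplies the
constant `2 / π` in the asymptotics. -/
theorem invSqrtCoeff_sq_mul_wallis (n : ℕ) :
    invSqrtCoeff n ^ 2 * (2 * n + 1) * Real.Wallis.W n = 1 := by
  induction n with
  | zero => simp [invSqrtCoeff_zero, Real.Wallis.W]
  | succ n ih =>
    refine Eq.trans ?_ ih
    rw [Real.Wallis.W_succ, invSqrtCoeff_succ]
    push_cast
    have h : (2 * ((n : ℝ) + 1) + 1) = 2 * n + 3 := by ring
    rw [h]
    field_simp

theorem tendsto_invSqrtCoeff : Tendsto invSqrtCoeff atTop (𝓝 0) := by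
  have h1 : Tendsto (fun n : ℕ => invSqrtCoeff n ^ 2) atTop (𝓝 0) := by
    refine squeeze_zero (fun n => sq_nonneg _) (g := fun n : ℕ => 1 / ((n : ℝ) + 1)) (fun n => ?_)
      tendsto_one_div_add_atTop_nhds_zero_nat
    rw [le_div_iff₀ (by positivity)]
    refine le_trans ?_ (invSqrtCoeff_sq_mul_le n)
    exact mul_le_mul_of_nonneg_left (by linarith [n.cast_nonneg (α := ℝ)]) (sq_nonneg _)
  have h2 := h1.sqrt
  simpa [Real.sqrt_sq (invSqrtCoeff_pos _).le] using h2

theorem tendsto_sq_mul_invSqrtCoeff :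
    Tendsto (fun n : ℕ => invSqrtCoeff n ^ 2 * (2 * n + 1)) atTop (𝓝 (2 / Real.pi)) := by
  have h := Real.Wallis.tendsto_W_nhds_pi_div_two.inv₀ (by positivity)
  rw [inv_div] at h
  refine h.congr fun n => ?_
  exact (eq_inv_of_mul_eq_one_left (invSqrtCoeff_sq_mul_wallis n)).symm

theorem invSqrtCoeffInt_natCast (n : ℕ) : invSqrtCoeffInt n = invSqrtCoeff n := by
  simp [invSqrtCoeffInt]

theorem invSqrtCoeffInt_of_neg {k : ℤ} (hk : k < 0) : invSqrtCoeffInt k = 0 := by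
  simp [invSqrtCoeffInt, hk]

theorem invSqrtCoeffInt_nonneg (k : ℤ) : 0 ≤ invSqrtCoeffInt k := by
  unfold invSqrtCoeffInt
  split_ifs
  exacts [(invSqrtCoeff_pos _).le, le_rfl]

theorem invSqrtCoeffInt_le_one (k : ℤ) : invSqrtCoeffInt k ≤ 1 := by
  unfold invSqrtCoeffInt
  split_ifs
  exacts [invSqrtCoeff_le_one _, zero_le_one]

theorem abs_invSqrtCoeffInt_le_one (k : ℤ) : |invSqrtCoeffInt k| ≤ 1 := by
  rw [abs_of_nonneg (invSqrtCoeffInt_nonneg k)]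
  exact invSqrtCoeffInt_le_one k

/-- Clearing denominators makes the recurrence valid across the extension by zero: at `k = -1` the
factor `k + 1` vanishes. -/
theorem invSqrtCoeffInt_succ (k : ℤ) :
    2 * ((k : ℝ) + 1) * invSqrtCoeffInt (k + 1) = (2 * k + 1) * invSqrtCoeffInt k := by
  rcases lt_trichotomy k (-1) with h | h | h
  · rw [invSqrtCoeffInt_of_neg (by lia), invSqrtCoeffInt_of_neg (by lia)]
    simp
  · subst h
    rw [invSqrtCoeffInt_of_neg (k := -1) (by lia)]
    simp
  · obtain ⟨n, rfl⟩ := Int.eq_ofNat_of_zero_le (by lia : 0 ≤ k)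
    have h1 := invSqrtCoeffInt_natCast (n + 1)
    push_cast at h1
    rw [h1, invSqrtCoeffInt_natCast, invSqrtCoeff_succ]
    push_cast
    field_simp

theorem sqrtCoeff_zero : sqrtCoeff 0 = 1 := by simp [sqrtCoeff, invSqrtCoeff_zero]

theorem two_mul_sub_one_ne_zero (n : ℕ) : (2 * n - 1 : ℝ) ≠ 0 := by
  intro h
  have : (2 * n : ℝ) = 1 := by linarith
  have : 2 * n = 1 := by exact_mod_cast this
  lia

theorem one_sub_two_mul_ne_zero (n : ℕ) : (1 - 2 * n : ℝ) ≠ 0 := by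
  have := two_mul_sub_one_ne_zero n
  intro h
  exact this (by linarith)

theorem sqrtCoeff_succ_nonpos (n : ℕ) : sqrtCoeff (n + 1) ≤ 0 := by
  have := invSqrtCoeff_pos (n + 1)
  refine div_nonpos_of_nonneg_of_nonpos this.le ?_
  push_cast
  linarith [n.cast_nonneg (α := ℝ)]

theorem sqrtCoeff_one : sqrtCoeff 1 = -1 / 2 := by
  rw [sqrtCoeff, invSqrtCoeff_succ 0, invSqrtCoeff_zero]
  norm_num

theorem sqrtCoeff_succ_eq_sub (n : ℕ) :
    sqrtCoeff (n + 1) = invSqrtCoeff (n + 1) - invSqrtCoeff n := by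
  have h := one_sub_two_mul_ne_zero (n + 1)
  rw [sqrtCoeff, div_eq_iff h, invSqrtCoeff_succ]
  push_cast
  field_simp
  ring

theorem sum_range_sqrtCoeff (N : ℕ) : ∑ j ∈ range (N + 1), sqrtCoeff j = invSqrtCoeff N := by
  induction N with
  | zero => simp [sqrtCoeff_zero, invSqrtCoeff_zero]
  | succ N ih => rw [sum_range_succ, ih, sqrtCoeff_succ_eq_sub]; ring

/-- All coefficients after the first have one sign, and the partial sums of the whole series are
`invSqrtCoeff N`, which tends to `0`. The exact mass `1` is what the maximum principle needs. -/
theorem hasSum_abs_sqrtCoeff_succ : HasSum (fun n => |sqrtCoeff (n + 1)|) 1 := by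
  rw [hasSum_iff_tendsto_nat_of_nonneg (fun _ => abs_nonneg _)]
  have h : ∀ N, ∑ j ∈ range N, |sqrtCoeff (j + 1)| = 1 - invSqrtCoeff N := by
    intro N
    have h1 := sum_range_sqrtCoeff N
    rw [sum_range_succ', sqrtCoeff_zero] at h1
    simp only [abs_of_nonpos (sqrtCoeff_succ_nonpos _), sum_neg_distrib]
    linarith
  simpa [h] using tendsto_invSqrtCoeff.const_sub 1

theorem summable_abs_sqrtCoeff : Summable fun n => |sqrtCoeff n| :=
  (summable_nat_add_iff 1).1 hasSum_abs_sqrtCoeff_succ.summable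

theorem invSqrtCoeff_eq_multichoose (n : ℕ) :
    invSqrtCoeff n = Ring.multichoose (1 / 2 : ℝ) n := by
  have h : ∀ n : ℕ, (n.factorial : ℝ) * Ring.multichoose (1 / 2 : ℝ) n =
      (ascPochhammer ℝ n).eval (1 / 2) := by
    intro n
    rw [← nsmul_eq_mul, Ring.factorial_nsmul_multichoose_eq_ascPochhammer,
      Polynomial.ascPochhammer_smeval_eq_eval]
  induction n with
  | zero => simp [invSqrtCoeff_zero]
  | succ n ih =>
    have h1 := h (n + 1)
    rw [ascPochhammer_succ_right, Polynomial.eval_mul, ← h n, ← ih, Nat.factorial_succ] at h1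
    have hf : (n.factorial : ℝ) ≠ 0 := by exact_mod_cast n.factorial_ne_zero
    rw [invSqrtCoeff_succ]
    simp only [Nat.cast_mul, Polynomial.eval_add, Polynomial.eval_X,
      Polynomial.eval_natCast, Nat.cast_add, Nat.cast_one] at h1
    have h2 : ((n : ℝ) + 1) * Ring.multichoose (1 / 2 : ℝ) (n + 1) =
        invSqrtCoeff n * (1 / 2 + n) := by
      apply mul_left_cancel₀ hf
      linarith
    have h3 : Ring.multichoose (1 / 2 : ℝ) (n + 1) = invSqrtCoeff n * (1 / 2 + n) / (n + 1) := by
      rw [← h2]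
      field_simp
    rw [h3]
    field_simp
    ring

/-- Chu–Vandermonde with both exponents `-1/2`: the square of `(1 - z) ^ (-1/2)` is the geometric
series. -/
theorem sum_antidiagonal_invSqrtCoeff (n : ℕ) :
    ∑ p ∈ antidiagonal n, invSqrtCoeff p.1 * invSqrtCoeff p.2 = 1 := by
  have h1 : ∀ m : ℕ, invSqrtCoeff m = (-1) ^ m * Ring.choose (-(1 / 2) : ℝ) m := by
    intro m
    rw [Ring.choose_neg', invSqrtCoeff_eq_multichoose, Units.smul_def, zsmul_eq_mul, ← mul_assoc]
    simp [← mul_pow]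
  have h2 := Ring.add_choose_eq n (Commute.all (-(1 / 2) : ℝ) (-(1 / 2)))
  have h3 : ∑ p ∈ antidiagonal n, invSqrtCoeff p.1 * invSqrtCoeff p.2 =
      (-1) ^ n * Ring.choose (-(1 / 2) + -(1 / 2) : ℝ) n := by
    rw [h2, mul_sum]
    refine sum_congr rfl fun p hp => ?_
    rw [h1, h1, ← mem_antidiagonal.1 hp, pow_add]
    ring
  rw [h3]
  have h4 : (-(1 / 2) + -(1 / 2) : ℝ) = -1 := by norm_num
  rw [h4, Ring.choose_neg, Units.smul_def, zsmul_eq_mul, ← mul_assoc]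
  have h5 : (1 + (n : ℝ) - 1) = (n : ℝ) := by ring
  rw [h5, Ring.choose_natCast]
  simp [← mul_pow]

theorem mk_sqrtCoeff_mul_mk_invSqrtCoeff :
    PowerSeries.mk sqrtCoeff * PowerSeries.mk invSqrtCoeff = 1 := by
  have h1 : PowerSeries.mk invSqrtCoeff * PowerSeries.mk invSqrtCoeff = PowerSeries.mk 1 := by
    ext n
    simp [PowerSeries.coeff_mul, sum_antidiagonal_invSqrtCoeff]
  have h2 : PowerSeries.mk sqrtCoeff = (1 - PowerSeries.X) * PowerSeries.mk invSqrtCoeff := by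
    ext n
    cases n with
    | zero => simp [sqrtCoeff_zero, invSqrtCoeff_zero]
    | succ n => simp [sub_mul, PowerSeries.coeff_succ_X_mul, sqrtCoeff_succ_eq_sub]
  rw [h2, mul_assoc, h1, mul_comm]
  exact PowerSeries.mk_one_mul_one_sub_eq_one ℝ

theorem hasSum_invSqrtCoeff {z : ℂ} (hz : ‖z‖ < 1) :
    HasSum (fun n => (invSqrtCoeff n : ℂ) * z ^ n) (1 / Complex.sqrt (1 - z)) := by
  have h := Complex.one_div_one_sub_cpow_hasFPowerSeriesOnBall_zero (2⁻¹ : ℂ)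
  have h1 := h.hasSum (y := z) (by simpa [← ENNReal.ofReal_one, Metric.eball_ofReal] using hz)
  simp only [zero_add] at h1
  refine h1.congr_fun fun n => ?_
  have : Ring.choose ((2⁻¹ : ℂ) + n - 1) n = (invSqrtCoeff n : ℂ) := by
    rw [invSqrtCoeff_eq_multichoose, Ring.multichoose_eq, Complex.ofReal_choose]
    push_cast
    norm_num
  simp [this, mul_comm]

/-! ### The Wiener–Hopf factorization in coefficients -/

theorem tendsto_natCast_add_div_add (α β : ℝ) :
    Tendsto (fun N : ℕ => (N + α) / (N + β)) atTop (𝓝 1) := by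
  have h0 : Tendsto (fun N : ℕ => (N : ℝ) + β) atTop atTop :=
    tendsto_atTop_add_const_right _ _ tendsto_natCast_atTop_atTop
  have h1 : Tendsto (fun N : ℕ => 1 + (α - β) / (N + β)) atTop (𝓝 1) := by
    simpa using (tendsto_const_nhds.div_atTop h0).const_add 1
  refine h1.congr' ?_
  filter_upwards [h0.eventually_gt_atTop 0] with N hN
  field_simp
  ring

/-- The case `k = 0` is Wallis' formula; a unit shift of `k` in either direction multiplies by a
ratio tending to `1`. -/
theorem tendsto_natCast_mul_invSqrtCoeff_mul (k : ℤ) :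
    Tendsto (fun N : ℕ => N * (invSqrtCoeff N * invSqrtCoeffInt (N + k))) atTop
      (𝓝 (1 / Real.pi)) := by
  have hlarge : ∀ k : ℤ, ∀ᶠ N : ℕ in atTop, (0 : ℝ) < N + k - 1 := by
    intro k
    have h0 : Tendsto (fun N : ℕ => (N : ℝ) + (k - 1)) atTop atTop :=
      tendsto_atTop_add_const_right _ _ tendsto_natCast_atTop_atTop
    filter_upwards [h0.eventually_gt_atTop 0] with N hN
    linarith
  induction k using Int.induction_on with
  | zero =>
    have h1 := tendsto_sq_mul_invSqrtCoeff.mul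
      ((tendsto_natCast_add_div_add 0 (1 / 2)).mul_const (1 / 2))
    have h2 : 2 / Real.pi * (1 * (1 / 2)) = 1 / Real.pi := by ring
    rw [h2] at h1
    refine h1.congr fun N => ?_
    simp only [add_zero, invSqrtCoeffInt_natCast]
    field_simp
  | succ i ih =>
    have h1 := ih.mul (tendsto_natCast_add_div_add (i + 1 / 2) (i + 1))
    rw [mul_one] at h1
    refine h1.congr' ?_
    filter_upwards [hlarge i] with N hN
    have h2 := invSqrtCoeffInt_succ (N + i)
    have h4 : (N : ℤ) + (i + 1) = N + i + 1 := by ring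
    rw [h4]
    push_cast at h2 hN
    have h3 : (N + (i + 1) : ℝ) ≠ 0 := by linarith
    rw [mul_div_assoc', div_eq_iff h3]
    linear_combination (-N * invSqrtCoeff N / 2) * h2
  | pred i ih =>
    have h1 := ih.mul (tendsto_natCast_add_div_add (-i) (-i - 1 / 2))
    rw [mul_one] at h1
    refine h1.congr' ?_
    filter_upwards [hlarge (-i)] with N hN
    have h2 := invSqrtCoeffInt_succ (N + (-i - 1))
    have h4 : (N : ℤ) + (-i - 1) + 1 = N + -i := by ring
    rw [h4] at h2
    push_cast at h2 hN
    have h3 : (N + (-i - 1 / 2) : ℝ) ≠ 0 := by linarith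
    rw [mul_div_assoc', div_eq_iff h3]
    linear_combination (N * invSqrtCoeff N / 2) * h2

/-- The coefficient form of `√(1 - ζ̄) · (1 / √(1 - ζ)) = 1 / √(-ζ)`. -/
theorem hasSum_sqrtCoeff_mul_invSqrtCoeffInt (k : ℤ) :
    HasSum (fun j : ℕ => sqrtCoeff j * invSqrtCoeffInt (j + k)) (1 / (Real.pi * (k + 1 / 2))) := by
  have hsum : Summable fun j : ℕ => sqrtCoeff j * invSqrtCoeffInt (j + k) := by
    refine Summable.of_norm_bounded summable_abs_sqrtCoeff fun j => ?_
    rw [norm_mul, Real.norm_eq_abs, Real.norm_eq_abs]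
    exact mul_le_of_le_one_right (abs_nonneg _) (abs_invSqrtCoeffInt_le_one _)
  have hk : (2 * k + 1 : ℝ) ≠ 0 := by
    intro h
    have : (2 * k + 1 : ℤ) = 0 := by exact_mod_cast h
    lia
  -- The summand has a hypergeometric antidifference, so the partial sums are explicit and the limit
  -- reduces to `N · invSqrtCoeff N · invSqrtCoeffInt (N + k) → 1 / π`.
  have hpart : ∀ N : ℕ, ∑ j ∈ range N, sqrtCoeff j * invSqrtCoeffInt (j + k) =
      4 * N * (N + k) * (invSqrtCoeff N * invSqrtCoeffInt (N + k)) /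
        ((2 * N - 1) * (2 * k + 1)) := by
    intro N
    induction N with
    | zero => simp
    | succ N ih =>
      rw [sum_range_succ, ih, sqrtCoeff, invSqrtCoeff_succ]
      have h1 := invSqrtCoeffInt_succ (N + k)
      have h2 := two_mul_sub_one_ne_zero N
      have h3 := one_sub_two_mul_ne_zero N
      have h4 : ((N + 1 : ℕ) : ℤ) + k = N + k + 1 := by push_cast; ring
      rw [h4]
      have h5 : (2 * ((N : ℝ) + 1) - 1) = 2 * N + 1 := by ring
      push_cast at h1 ⊢
      rw [h5]
      have h6 : 4 * ((N : ℝ) + 1) * (N + 1 + k) *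
          (invSqrtCoeff N * ((2 * N + 1) / (2 * N + 2)) * invSqrtCoeffInt (N + k + 1)) /
            ((2 * N + 1) * (2 * k + 1)) =
          invSqrtCoeff N * (2 * (N + k + 1) * invSqrtCoeffInt (N + k + 1)) / (2 * k + 1) := by
        field_simp
        ring
      rw [h6, h1, ← neg_sub (2 * (N : ℝ)) 1]
      generalize invSqrtCoeffInt (N + k) = y
      have h7 : -(2 * (N : ℝ) - 1) ≠ 0 := by simpa using h3
      rw [div_mul_eq_mul_div, div_add_div _ _ (mul_ne_zero h2 hk) h7,
        div_eq_div_iff (mul_ne_zero (mul_ne_zero h2 hk) h7) hk]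
      ring
  have hlim : Tendsto (fun N : ℕ => 4 * N * (N + k) * (invSqrtCoeff N * invSqrtCoeffInt (N + k)) /
        ((2 * N - 1) * (2 * k + 1) : ℝ)) atTop (𝓝 (1 / (Real.pi * (k + 1 / 2)))) := by
    have h1 := (tendsto_natCast_mul_invSqrtCoeff_mul k).mul
      ((tendsto_natCast_add_div_add k (-1 / 2)).mul_const (2 / (2 * k + 1) : ℝ))
    have h2 : 1 / Real.pi * (1 * (2 / (2 * k + 1))) = 1 / (Real.pi * (k + 1 / 2)) := by
      have : (k + 1 / 2 : ℝ) = (2 * k + 1) / 2 := by ring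
      rw [this]
      field_simp
    rw [h2] at h1
    refine h1.congr fun N => ?_
    have h3 := two_mul_sub_one_ne_zero N
    have h4 : (N + -1 / 2 : ℝ) = (2 * N - 1) / 2 := by ring
    rw [h4]
    field_simp
    ring
  have h := hsum.hasSum
  have h1 := h.tendsto_sum_nat
  simp only [hpart] at h1
  rwa [tendsto_nhds_unique h1 hlim] at h

/-! ### Fourier coefficients of `1 / √(-ζ)` and the Hilbert inequality -/

/-- The `k`-th Fourier coefficient of a function on the unit circle. -/
def circleCoeff (F : ℂ → ℂ) (k : ℤ) : ℂ :=
  (2 * (Real.pi : ℂ) * Complex.I)⁻¹ * ∮ ζ in C(0, 1), ζ ^ (-(k + 1)) * F ζ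

theorem circleCoeff_eq_intervalIntegral (F : ℂ → ℂ) (k : ℤ) :
    circleCoeff F k = (2 * (Real.pi : ℂ))⁻¹ *
      ∫ θ in (0 : ℝ)..2 * Real.pi, (circleMap 0 1 θ) ^ (-k) * F (circleMap 0 1 θ) := by
  have h1 : ∀ θ : ℝ, deriv (circleMap 0 1) θ •
      ((circleMap 0 1 θ) ^ (-(k + 1)) * F (circleMap 0 1 θ)) =
      Complex.I * ((circleMap 0 1 θ) ^ (-k) * F (circleMap 0 1 θ)) := by
    intro θ
    have h0 : circleMap 0 1 θ ≠ 0 := circleMap_ne_center one_ne_zero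
    have h2 : -(k + 1) = -k - 1 := by ring
    rw [deriv_circleMap, smul_eq_mul, h2, zpow_sub_one₀ h0]
    field_simp
  rw [circleCoeff, circleIntegral]
  simp only [h1]
  rw [intervalIntegral.integral_const_mul]
  have := Complex.I_ne_zero
  field_simp

theorem circleMap_zero_one_zpow (θ : ℝ) (k : ℤ) :
    circleMap 0 1 θ ^ k = Complex.exp (k * Complex.I * θ) := by
  rw [circleMap, zero_add, Complex.ofReal_one, one_mul, ← Complex.exp_int_mul]
  congr 1
  ring

/-- Here `-e ^ (iθ) = e ^ (i(θ - π))` with `θ - π` in the principal range `(-π, π]`. -/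
theorem one_div_sqrt_neg_circleMap {θ : ℝ} (hθ : θ ∈ Set.Ioc 0 (2 * Real.pi)) :
    1 / Complex.sqrt (-circleMap 0 1 θ) =
      Complex.I * Complex.exp (-(1 / 2) * Complex.I * θ) := by
  have h1 : -circleMap 0 1 θ = Complex.exp ((θ - Real.pi) * Complex.I) := by
    rw [sub_mul, Complex.exp_sub, Complex.exp_pi_mul_I]
    simp [circleMap, div_neg]
  have h2 : Complex.log (Complex.exp ((θ - Real.pi) * Complex.I)) = (θ - Real.pi) * Complex.I := by
    apply Complex.log_exp <;> simp <;> linarith [hθ.1, hθ.2]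
  rw [h1, sqrt_eq_exp (Complex.exp_ne_zero _), h2, one_div, ← Complex.exp_neg]
  have h3 : -((θ - Real.pi) * Complex.I / 2) =
      Real.pi / 2 * Complex.I + -(1 / 2) * Complex.I * θ := by ring
  rw [h3, Complex.exp_add, Complex.exp_pi_div_two_mul_I]

theorem circleCoeff_one_div_sqrt_neg (k : ℤ) :
    circleCoeff (fun ζ => 1 / Complex.sqrt (-ζ)) k = ((1 / (Real.pi * (k + 1 / 2)) : ℝ) : ℂ) := by
  have hk : (k + 1 / 2 : ℂ) ≠ 0 := by
    intro h
    have h1 : (2 * k + 1 : ℂ) = 0 := by linear_combination 2 * h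
    have : (2 * k + 1 : ℤ) = 0 := by exact_mod_cast h1
    lia
  have hpi : (Real.pi : ℂ) ≠ 0 := by exact_mod_cast Real.pi_ne_zero
  have hI := Complex.I_ne_zero
  have h1 : ∫ θ in (0 : ℝ)..2 * Real.pi,
      (circleMap 0 1 θ) ^ (-k) * (1 / Complex.sqrt (-circleMap 0 1 θ)) =
      ∫ θ in (0 : ℝ)..2 * Real.pi, Complex.I * Complex.exp (-(k + 1 / 2) * Complex.I * θ) := by
    refine intervalIntegral.integral_congr_ae (Eventually.of_forall fun θ hθ => ?_)
    rw [Set.uIoc_of_le (by positivity)] at hθ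
    rw [one_div_sqrt_neg_circleMap hθ, circleMap_zero_one_zpow, mul_left_comm, ← Complex.exp_add]
    push_cast
    ring_nf
  have h2 : Complex.exp (-(k + 1 / 2) * Complex.I * ((2 * Real.pi : ℝ) : ℂ)) = -1 := by
    have h3 : -(k + 1 / 2) * Complex.I * ((2 * Real.pi : ℝ) : ℂ) =
        -(Real.pi * Complex.I) + ((-k : ℤ) : ℂ) * (2 * Real.pi * Complex.I) := by
      push_cast
      ring
    rw [h3, Complex.exp_add, Complex.exp_int_mul_two_pi_mul_I, Complex.exp_neg,
      Complex.exp_pi_mul_I]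
    norm_num
  rw [circleCoeff_eq_intervalIntegral, h1, intervalIntegral.integral_const_mul,
    integral_exp_mul_complex (mul_ne_zero (neg_ne_zero.2 hk) hI), h2]
  push_cast
  simp only [mul_zero, Complex.exp_zero]
  field_simp
  ring

theorem integral_exp_int_mul_I (k : ℤ) :
    ∫ θ in (0 : ℝ)..2 * Real.pi, Complex.exp (k * Complex.I * θ) =
      if k = 0 then 2 * (Real.pi : ℂ) else 0 := by
  split_ifs with h
  · simp [h]
  · have h0 : (k : ℂ) * Complex.I ≠ 0 := mul_ne_zero (by exact_mod_cast h) Complex.I_ne_zero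
    rw [integral_exp_mul_complex h0]
    have h3 : k * Complex.I * ((2 * Real.pi : ℝ) : ℂ) = k * (2 * Real.pi * Complex.I) := by
      push_cast
      ring
    rw [h3, Complex.exp_int_mul_two_pi_mul_I]
    simp

theorem integral_norm_sq_trig_sum (s : Finset ℕ) (x : ℕ → ℝ) :
    ∫ θ in (0 : ℝ)..2 * Real.pi, ‖∑ m ∈ s, (x m : ℂ) * circleMap 0 1 θ ^ (m : ℤ)‖ ^ 2 =
      2 * Real.pi * ∑ m ∈ s, x m ^ 2 := by
  have h1 : ∀ θ : ℝ, ((‖∑ m ∈ s, (x m : ℂ) * circleMap 0 1 θ ^ (m : ℤ)‖ ^ 2 : ℝ) : ℂ) =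
      ∑ m ∈ s, ∑ n ∈ s, (x m * x n : ℂ) * Complex.exp (((m - n : ℤ) : ℂ) * Complex.I * θ) := by
    intro θ
    rw [← Complex.normSq_eq_norm_sq, ← Complex.mul_conj, map_sum, sum_mul_sum]
    refine sum_congr rfl fun m _ => sum_congr rfl fun n _ => ?_
    rw [circleMap_zero_one_zpow, circleMap_zero_one_zpow, map_mul, Complex.conj_ofReal,
      ← Complex.exp_conj, mul_mul_mul_comm, ← Complex.exp_add]
    congr 2
    simp
    ring
  apply Complex.ofReal_injective
  rw [← intervalIntegral.integral_ofReal]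
  simp only [h1]
  rw [intervalIntegral.integral_finsetSum]
  · simp_rw [Complex.ofReal_mul, Complex.ofReal_sum, mul_sum]
    refine sum_congr rfl fun m hm => ?_
    rw [intervalIntegral.integral_finsetSum]
    · simp only [intervalIntegral.integral_const_mul, integral_exp_int_mul_I]
      rw [sum_eq_single m]
      · simp
        ring
      · intro n _ hn
        have : (m : ℤ) - n ≠ 0 := by lia
        simp [this]
      · exact fun h => absurd hm h
    · intro n _
      exact Continuous.intervalIntegrable (by fun_prop) _ _
  · intro m _
    exact Continuous.intervalIntegrable (by fun_prop) _ _

/-- The Hilbert inequality for the matrix `1 / (n - m + 1/2)`. -/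
theorem abs_sum_div_sub_add_half_le (s : Finset ℕ) (x y : ℕ → ℝ) :
    |∑ n ∈ s, ∑ m ∈ s, 1 / ((n : ℝ) - m + 1 / 2) * x m * y n| ≤
      Real.pi / 2 * (∑ m ∈ s, x m ^ 2 + ∑ n ∈ s, y n ^ 2) := by
  set X : ℝ → ℂ := fun θ => ∑ m ∈ s, (x m : ℂ) * circleMap 0 1 θ ^ (m : ℤ) with hX
  set Y : ℝ → ℂ := fun θ => ∑ m ∈ s, (y m : ℂ) * circleMap 0 1 θ ^ (m : ℤ) with hY
  have hcontX : Continuous X := by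
    simp only [hX, circleMap_zero_one_zpow]
    fun_prop
  have hcontY : Continuous Y := by
    simp only [hY, circleMap_zero_one_zpow]
    fun_prop
  -- The integral of `Φ` is twice the bilinear form. As the symbol is unimodular, `‖Φ‖ = ‖X‖ ‖Y‖`,
  -- and the AM–GM inequality with Parseval gives the bound.
  set Φ : ℝ → ℂ := fun θ => Complex.I * Complex.exp (-(1 / 2) * Complex.I * θ) * X θ * conj (Y θ)
    with hΦ
  have hcontΦ : Continuous Φ := by
    have := Complex.continuous_conj.comp hcontY
    simp only [hΦ]
    fun_prop
  have h1 : ∫ θ in (0 : ℝ)..2 * Real.pi, Φ θ =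
      ((2 * ∑ n ∈ s, ∑ m ∈ s, 1 / ((n : ℝ) - m + 1 / 2) * x m * y n : ℝ) : ℂ) := by
    have h2 : ∀ θ, Φ θ = ∑ n ∈ s, ∑ m ∈ s, (x m * y n : ℂ) *
        (Complex.I * Complex.exp (-(1 / 2) * Complex.I * θ) *
          circleMap 0 1 θ ^ (-(n - m : ℤ))) := by
      intro θ
      simp only [hΦ, hX, hY, map_sum, mul_sum, sum_mul]
      refine sum_congr rfl fun n _ => sum_congr rfl fun m _ => ?_
      rw [map_mul, Complex.conj_ofReal]
      have h3 : conj (circleMap 0 1 θ ^ (n : ℤ)) = circleMap 0 1 θ ^ (-n : ℤ) := by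
        rw [circleMap_zero_one_zpow, circleMap_zero_one_zpow, ← Complex.exp_conj]
        congr 1
        simp
      have h4 : (-(n - m : ℤ)) = m + -n := by ring
      rw [h3, h4, zpow_add₀ (circleMap_ne_center one_ne_zero)]
      ring
    have h5 : ∀ k : ℤ, ∫ θ in (0 : ℝ)..2 * Real.pi,
        Complex.I * Complex.exp (-(1 / 2) * Complex.I * θ) * circleMap 0 1 θ ^ (-k) =
          ((2 / (k + 1 / 2) : ℝ) : ℂ) := by
      intro k
      have h6 := circleCoeff_one_div_sqrt_neg k
      rw [circleCoeff_eq_intervalIntegral] at h6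
      have h7 : ∫ θ in (0 : ℝ)..2 * Real.pi,
          Complex.I * Complex.exp (-(1 / 2) * Complex.I * θ) * circleMap 0 1 θ ^ (-k) =
          ∫ θ in (0 : ℝ)..2 * Real.pi,
            (circleMap 0 1 θ) ^ (-k) * (1 / Complex.sqrt (-circleMap 0 1 θ)) := by
        refine intervalIntegral.integral_congr_ae (Eventually.of_forall fun θ hθ => ?_)
        rw [Set.uIoc_of_le (by positivity)] at hθ
        rw [one_div_sqrt_neg_circleMap hθ, mul_comm]
      have hpi : (Real.pi : ℂ) ≠ 0 := by exact_mod_cast Real.pi_ne_zero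
      rw [h7, ← mul_right_inj' (inv_ne_zero (mul_ne_zero two_ne_zero hpi)), h6]
      push_cast
      field_simp
    simp only [h2]
    rw [intervalIntegral.integral_finsetSum]
    · rw [Complex.ofReal_mul, Complex.ofReal_sum, mul_sum]
      refine sum_congr rfl fun n _ => ?_
      rw [intervalIntegral.integral_finsetSum]
      · rw [Complex.ofReal_sum, mul_sum]
        refine sum_congr rfl fun m _ => ?_
        rw [intervalIntegral.integral_const_mul, h5]
        push_cast
        ring
      · intro m _
        simp only [circleMap_zero_one_zpow]
        exact Continuous.intervalIntegrable (by fun_prop) _ _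
    · intro n _
      simp only [circleMap_zero_one_zpow]
      exact Continuous.intervalIntegrable (by fun_prop) _ _
  have h2 : ‖∫ θ in (0 : ℝ)..2 * Real.pi, Φ θ‖ ≤
      ∫ θ in (0 : ℝ)..2 * Real.pi, (1 / 2 : ℝ) * (‖X θ‖ ^ 2 + ‖Y θ‖ ^ 2) := by
    refine intervalIntegral.norm_integral_le_of_norm_le (by positivity)
      (Eventually.of_forall fun θ _ => ?_) (Continuous.intervalIntegrable (by fun_prop) _ _)
    have h3 : ‖Complex.exp (-(1 / 2) * Complex.I * θ)‖ = 1 := by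
      have : -(1 / 2) * Complex.I * θ = ((-(1 / 2) * θ : ℝ) : ℂ) * Complex.I := by
        push_cast
        ring
      rw [this, Complex.norm_exp_ofReal_mul_I]
    simp only [hΦ]
    rw [norm_mul, norm_mul, norm_mul, Complex.norm_I, h3, RCLike.norm_conj]
    nlinarith [sq_nonneg (‖X θ‖ - ‖Y θ‖)]
  rw [h1, intervalIntegral.integral_const_mul, intervalIntegral.integral_add
    (Continuous.intervalIntegrable (by fun_prop) _ _)
    (Continuous.intervalIntegrable (by fun_prop) _ _), integral_norm_sq_trig_sum,
    integral_norm_sq_trig_sum, Complex.norm_real, Real.norm_eq_abs, abs_mul] at h2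
  rw [abs_of_pos (by norm_num : (0 : ℝ) < 2)] at h2
  linarith

/-! ### Schur's test and the weighted Hilbert matrix -/

/-- **Schur's test**, for bilinear forms on finite sequences. -/
theorem schur_test (s : Finset ℕ) {K : ℕ → ℕ → ℝ} {p : ℕ → ℝ} {C : ℝ} (hK : ∀ n m, 0 ≤ K n m)
    (hp : ∀ n, 0 < p n) (h1 : ∀ n, ∑ m ∈ s, K n m * p m ≤ C * p n)
    (h2 : ∀ m, ∑ n ∈ s, K n m * p n ≤ C * p m) (x y : ℕ → ℝ) :
    ∑ n ∈ s, ∑ m ∈ s, K n m * |x m| * |y n| ≤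
      C / 2 * (∑ m ∈ s, x m ^ 2 + ∑ n ∈ s, y n ^ 2) := by
  -- Weighted AM–GM; the weights are chosen so that summing each half over one index produces one of
  -- the two hypotheses.
  have h3 : ∀ n m, K n m * |x m| * |y n| ≤
      K n m * p n * (x m ^ 2 / p m / 2) + K n m * p m * (y n ^ 2 / p n / 2) := by
    intro n m
    have hn := hp n
    have hm := hp m
    have h4 : |x m| * |y n| ≤ p n * (x m ^ 2 / p m / 2) + p m * (y n ^ 2 / p n / 2) := by
      have e : p n * (x m ^ 2 / p m / 2) + p m * (y n ^ 2 / p n / 2) =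
          ((p n * |x m|) ^ 2 + (p m * |y n|) ^ 2) / (2 * (p n * p m)) := by
        rw [mul_pow, mul_pow, sq_abs, sq_abs]
        field_simp
      rw [e, le_div_iff₀ (by positivity)]
      nlinarith [sq_nonneg (p n * |x m| - p m * |y n|)]
    nlinarith [mul_le_mul_of_nonneg_left h4 (hK n m)]
  calc ∑ n ∈ s, ∑ m ∈ s, K n m * |x m| * |y n|
      ≤ ∑ n ∈ s, ∑ m ∈ s,
        (K n m * p n * (x m ^ 2 / p m / 2) + K n m * p m * (y n ^ 2 / p n / 2)) :=
        sum_le_sum fun n _ => sum_le_sum fun m _ => h3 n m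
    _ = ∑ m ∈ s, (∑ n ∈ s, K n m * p n) * (x m ^ 2 / p m / 2) +
        ∑ n ∈ s, (∑ m ∈ s, K n m * p m) * (y n ^ 2 / p n / 2) := by
        simp only [sum_add_distrib, sum_mul]
        rw [sum_comm]
    _ ≤ ∑ m ∈ s, (C * p m) * (x m ^ 2 / p m / 2) + ∑ n ∈ s, (C * p n) * (y n ^ 2 / p n / 2) := by
        refine add_le_add (sum_le_sum fun m _ => ?_) (sum_le_sum fun n _ => ?_)
        · have := hp m
          exact mul_le_mul_of_nonneg_right (h2 m) (by positivity)
        · have := hp n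
          exact mul_le_mul_of_nonneg_right (h1 n) (by positivity)
    _ = C / 2 * (∑ m ∈ s, x m ^ 2 + ∑ n ∈ s, y n ^ 2) := by
        rw [mul_add, mul_sum, mul_sum]
        congr 1 <;> refine sum_congr rfl fun m _ => ?_
        all_goals
          have := hp m
          field_simp

/-- The weight `(1 + n) ^ (1 / 4)`. -/
def quarterWeight (n : ℕ) : ℝ := (1 + (n : ℝ)) ^ (1 / 4 : ℝ)

theorem quarterWeight_pos (n : ℕ) : 0 < quarterWeight n := by
  unfold quarterWeight
  positivity

theorem quarterWeight_pow_four (n : ℕ) : quarterWeight n ^ 4 = 1 + n := by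
  have h : (0 : ℝ) ≤ 1 + n := by positivity
  rw [quarterWeight, ← Real.rpow_natCast, ← Real.rpow_mul h]
  norm_num

theorem quarterWeight_mono {m n : ℕ} (h : m ≤ n) : quarterWeight m ≤ quarterWeight n := by
  have : (m : ℝ) ≤ n := by exact_mod_cast h
  unfold quarterWeight
  gcongr

theorem quarterWeight_zero : quarterWeight 0 = 1 := by simp [quarterWeight]

/-- A telescoping substitute for the integral test, as in the next three lemmas: consecutive fourth
powers of the weight differ by `1`, so `v² - u² = 1 / (v² + u²) ≥ 1 / (2v²)`. -/
theorem sum_quarterWeight_inv_sq (n : ℕ) :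
    ∑ m ∈ range (n + 1), 1 / quarterWeight m ^ 2 ≤ 2 * quarterWeight n ^ 2 := by
  induction n with
  | zero => norm_num [quarterWeight_zero]
  | succ n ih =>
    rw [sum_range_succ]
    have hu := quarterWeight_pos n
    have hv := quarterWeight_pos (n + 1)
    have hle := quarterWeight_mono n.le_succ
    have h1 := quarterWeight_pow_four n
    have h2 := quarterWeight_pow_four (n + 1)
    push_cast at h2
    set u := quarterWeight n
    set v := quarterWeight (n + 1)
    have h3 : 1 / v ^ 2 ≤ 2 * (v ^ 2 - u ^ 2) := by
      rw [div_le_iff₀ (by positivity)]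
      have : u ^ 2 ≤ v ^ 2 := by gcongr
      nlinarith [mul_nonneg (sub_nonneg.2 this) (sub_nonneg.2 this)]
    linarith

theorem sum_quarterWeight_inv_cube (n : ℕ) :
    ∑ m ∈ range (n + 1), 1 / quarterWeight m ^ 3 ≤ 4 * quarterWeight n := by
  induction n with
  | zero => norm_num [quarterWeight_zero]
  | succ n ih =>
    rw [sum_range_succ]
    have hu := quarterWeight_pos n
    have hv := quarterWeight_pos (n + 1)
    have hle := quarterWeight_mono n.le_succ
    have h1 := quarterWeight_pow_four n
    have h2 := quarterWeight_pow_four (n + 1)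
    push_cast at h2
    set u := quarterWeight n
    set v := quarterWeight (n + 1)
    have h3 : 1 / v ^ 3 ≤ 4 * (v - u) := by
      rw [div_le_iff₀ (by positivity)]
      have e : v ^ 4 - u ^ 4 = (v - u) * ((v + u) * (v ^ 2 + u ^ 2)) := by ring
      have h4 : (v + u) * (v ^ 2 + u ^ 2) ≤ (v + v) * (v ^ 2 + v ^ 2) := by gcongr
      have := mul_le_mul_of_nonneg_left h4 (sub_nonneg.2 hle)
      nlinarith
    linarith

theorem sum_quarterWeight_inv_pow_five (n L : ℕ) :
    ∑ i ∈ range L, 1 / quarterWeight (n + 1 + i) ^ 5 ≤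
      4 * (1 / quarterWeight n - 1 / quarterWeight (n + L)) := by
  induction L with
  | zero => simp
  | succ L ih =>
    rw [sum_range_succ]
    have e1 : n + 1 + L = n + L + 1 := by ring
    rw [e1, ← add_assoc n L 1]
    have hu := quarterWeight_pos (n + L)
    have hv := quarterWeight_pos (n + L + 1)
    have hle := quarterWeight_mono (n + L).le_succ
    have h1 := quarterWeight_pow_four (n + L)
    have h2 := quarterWeight_pow_four (n + L + 1)
    push_cast at h1 h2
    set u := quarterWeight (n + L)
    set v := quarterWeight (n + L + 1)
    have h3 : 1 / v ^ 5 ≤ 4 * (1 / u - 1 / v) := by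
      have e : (v - u) * ((v + u) * (v ^ 2 + u ^ 2)) = 1 := by linear_combination h2 - h1
      have e2 : 4 * (1 / u - 1 / v) = 4 / (u * v * ((v + u) * (v ^ 2 + u ^ 2))) := by
        rw [eq_div_iff (by positivity)]
        field_simp
        linear_combination e
      have h4 : u * v * ((v + u) * (v ^ 2 + u ^ 2)) ≤ v * v * ((v + v) * (v ^ 2 + v ^ 2)) := by
        gcongr
      rw [e2, div_le_div_iff₀ (by positivity) (by positivity)]
      linarith
    linarith

theorem sum_quarterWeight_inv_pow_six (n L : ℕ) :
    ∑ i ∈ range L, 1 / quarterWeight (n + 1 + i) ^ 6 ≤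
      2 * (1 / quarterWeight n ^ 2 - 1 / quarterWeight (n + L) ^ 2) := by
  induction L with
  | zero => simp
  | succ L ih =>
    rw [sum_range_succ]
    have e1 : n + 1 + L = n + L + 1 := by ring
    rw [e1, ← add_assoc n L 1]
    have hu := quarterWeight_pos (n + L)
    have hv := quarterWeight_pos (n + L + 1)
    have hle := quarterWeight_mono (n + L).le_succ
    have h1 := quarterWeight_pow_four (n + L)
    have h2 := quarterWeight_pow_four (n + L + 1)
    push_cast at h1 h2
    set u := quarterWeight (n + L)
    set v := quarterWeight (n + L + 1)
    have h3 : 1 / v ^ 6 ≤ 2 * (1 / u ^ 2 - 1 / v ^ 2) := by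
      have e : (v ^ 2 - u ^ 2) * (v ^ 2 + u ^ 2) = 1 := by linear_combination h2 - h1
      have e2 : 2 * (1 / u ^ 2 - 1 / v ^ 2) = 2 / (u ^ 2 * v ^ 2 * (v ^ 2 + u ^ 2)) := by
        rw [eq_div_iff (by positivity)]
        field_simp
        linear_combination e
      have h4 : u ^ 2 * v ^ 2 * (v ^ 2 + u ^ 2) ≤ v ^ 2 * v ^ 2 * (v ^ 2 + v ^ 2) := by
        gcongr
      rw [e2, div_le_div_iff₀ (by positivity) (by positivity)]
      linarith
    linarith

/-- A sum over an initial segment is split at `n`, with one majorant on each side. -/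
theorem sum_range_le_of_le_of_lt {φ ψ χ : ℕ → ℝ} {n : ℕ} (hφ : ∀ m, 0 ≤ φ m)
    (h1 : ∀ m, φ m ≤ ψ m) (h2 : ∀ m, φ m ≤ χ m) (L : ℕ) :
    ∑ m ∈ range L, φ m ≤ ∑ m ∈ range (n + 1), ψ m + ∑ i ∈ range L, χ (n + 1 + i) := by
  calc ∑ m ∈ range L, φ m ≤ ∑ m ∈ range (n + 1 + L), φ m :=
        sum_le_sum_of_subset_of_nonneg (range_subset_range.2 (by lia)) fun m _ _ => hφ m
    _ = ∑ m ∈ range (n + 1), φ m + ∑ i ∈ range L, φ (n + 1 + i) := sum_range_add _ _ _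
    _ ≤ _ := add_le_add (sum_le_sum fun m _ => h1 m) (sum_le_sum fun m _ => h2 _)

/-- The matrix `1 / (n - m + 1/2)` with the weights `((1 + m) / (1 + n)) ^ (1/4)`. -/
def weightedHilbert (n m : ℕ) : ℝ :=
  quarterWeight m / quarterWeight n / ((n : ℝ) - m + 1 / 2)

/-- The difference has numerator `x - y`, which cancels a factor of `n - m = y⁴ - x⁴`, and so the
singularity at the diagonal disappears. What remains is at most `2 / (y (x + y)(x² + y²))`; keeping
only `y` or only `x` in the last two factors gives the two bounds. -/
theorem abs_weightedHilbert_sub_le (n m : ℕ) :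
    |weightedHilbert n m - 1 / ((n : ℝ) - m + 1 / 2)| ≤ 2 / quarterWeight n ^ 4 ∧
    |weightedHilbert n m - 1 / ((n : ℝ) - m + 1 / 2)| ≤
      2 / (quarterWeight n * quarterWeight m ^ 3) := by
  have hx := quarterWeight_pos m
  have hy := quarterWeight_pos n
  have h1 := quarterWeight_pow_four m
  have h2 := quarterWeight_pow_four n
  rw [weightedHilbert]
  set x := quarterWeight m
  set y := quarterWeight n
  rcases eq_or_ne n m with rfl | hnm
  · have : x / x / ((n : ℝ) - n + 1 / 2) - 1 / ((n : ℝ) - n + 1 / 2) = 0 := by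
      rw [div_self hx.ne', sub_self]
    have e : y = x := rfl
    rw [e, this, abs_zero]
    constructor <;> positivity
  -- Off the diagonal `|n - m| ≥ 1`, so the shift by `1/2` costs at most a factor `2`.
  have hd : |(n : ℝ) - m| / 2 ≤ |(n : ℝ) - m + 1 / 2| := by
    have h3 : (1 : ℝ) ≤ |(n : ℝ) - m| := by
      have : (1 : ℤ) ≤ |(n : ℤ) - m| := Int.one_le_abs (by lia)
      exact_mod_cast this
    have h4 := abs_sub_abs_le_abs_sub ((n : ℝ) - m) (-(1 / 2))
    rw [sub_neg_eq_add, abs_neg, abs_of_pos (by norm_num : (0 : ℝ) < 1 / 2)] at h4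
    linarith
  have hnm' : (n : ℝ) - m ≠ 0 := sub_ne_zero.2 (by exact_mod_cast hnm)
  have e1 : (n : ℝ) - m = -(x - y) * ((x + y) * (x ^ 2 + y ^ 2)) := by
    linear_combination h1 - h2
  have hxy : x - y ≠ 0 := by
    intro h
    rw [h] at e1
    simp at e1
    exact hnm' e1
  have hpos : 0 < |x - y| := abs_pos.2 hxy
  have hS : 0 < (x + y) * (x ^ 2 + y ^ 2) := by positivity
  have e2 : |(n : ℝ) - m| = |x - y| * ((x + y) * (x ^ 2 + y ^ 2)) := by
    rw [e1, abs_mul, abs_neg, abs_of_pos hS]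
  have e3 : x / y / ((n : ℝ) - m + 1 / 2) - 1 / ((n : ℝ) - m + 1 / 2) =
      (x - y) / (y * ((n : ℝ) - m + 1 / 2)) := by
    rw [← sub_div, div_sub_one hy.ne', div_div]
  have key : |x / y / ((n : ℝ) - m + 1 / 2) - 1 / ((n : ℝ) - m + 1 / 2)| ≤
      2 / (y * ((x + y) * (x ^ 2 + y ^ 2))) := by
    rw [e3, abs_div, abs_mul, abs_of_pos hy]
    calc |x - y| / (y * |(n : ℝ) - m + 1 / 2|) ≤ |x - y| / (y * (|(n : ℝ) - m| / 2)) := by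
          have : 0 < |(n : ℝ) - m| := abs_pos.2 hnm'
          gcongr
      _ = 2 / (y * ((x + y) * (x ^ 2 + y ^ 2))) := by
          rw [e2]
          field_simp
  constructor
  · refine key.trans ?_
    gcongr
    have : (0 + y) * (0 ^ 2 + y ^ 2) ≤ (x + y) * (x ^ 2 + y ^ 2) := by gcongr
    nlinarith
  · refine key.trans ?_
    gcongr
    have : (x + 0) * (x ^ 2 + 0 ^ 2) ≤ (x + y) * (x ^ 2 + y ^ 2) := by gcongr
    nlinarith

theorem abs_sum_weightedHilbert_le (L : ℕ) (x y : ℕ → ℝ) :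
    |∑ n ∈ range L, ∑ m ∈ range L, weightedHilbert n m * x m * y n| ≤
      16 / 2 * (∑ m ∈ range L, x m ^ 2 + ∑ n ∈ range L, y n ^ 2) := by
  set K : ℕ → ℕ → ℝ := fun n m => |weightedHilbert n m - 1 / ((n : ℝ) - m + 1 / 2)| with hK
  -- The Schur weight `(1 + n) ^ (-1/2)` suits a kernel of homogeneity `-1`. Splitting at the
  -- diagonal gives `4 + 8` for rows and `8 + 4` for columns, hence the constant `12`.
  set p : ℕ → ℝ := fun n => 1 / quarterWeight n ^ 2 with hp
  have hp0 : ∀ n, 0 < p n := fun n => by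
    have := quarterWeight_pos n
    positivity
  have hK0 : ∀ n m, 0 ≤ K n m := fun n m => abs_nonneg _
  have hrow : ∀ n, ∑ m ∈ range L, K n m * p m ≤ 12 * p n := by
    intro n
    have hn := quarterWeight_pos n
    have h := sum_range_le_of_le_of_lt (n := n) (φ := fun m => K n m * p m)
      (ψ := fun m => 2 / quarterWeight n ^ 4 * (1 / quarterWeight m ^ 2))
      (χ := fun m => 2 / quarterWeight n * (1 / quarterWeight m ^ 5))
      (fun m => mul_nonneg (hK0 n m) (hp0 m).le)
      (fun m => mul_le_mul_of_nonneg_right (abs_weightedHilbert_sub_le n m).1 (hp0 m).le)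
      (fun m => by
        refine (mul_le_mul_of_nonneg_right (abs_weightedHilbert_sub_le n m).2 (hp0 m).le).trans
          (le_of_eq ?_)
        have := quarterWeight_pos m
        simp only [hp]
        field_simp) L
    refine h.trans ?_
    rw [← mul_sum, ← mul_sum]
    have h1 := mul_le_mul_of_nonneg_left (sum_quarterWeight_inv_sq n)
      (by positivity : 0 ≤ 2 / quarterWeight n ^ 4)
    have h2 : ∑ i ∈ range L, 1 / quarterWeight (n + 1 + i) ^ 5 ≤ 4 * (1 / quarterWeight n) := by
      have := quarterWeight_pos (n + L)
      have h3 : 0 ≤ 1 / quarterWeight (n + L) := by positivity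
      linarith [sum_quarterWeight_inv_pow_five n L]
    have h4 := mul_le_mul_of_nonneg_left h2 (by positivity : 0 ≤ 2 / quarterWeight n)
    refine (add_le_add h1 h4).trans (le_of_eq ?_)
    simp only [hp]
    field_simp
    norm_num
  have hcol : ∀ m, ∑ n ∈ range L, K n m * p n ≤ 12 * p m := by
    intro m
    have hm := quarterWeight_pos m
    have h := sum_range_le_of_le_of_lt (n := m) (φ := fun n => K n m * p n)
      (ψ := fun n => 2 / quarterWeight m ^ 3 * (1 / quarterWeight n ^ 3))
      (χ := fun n => 2 * (1 / quarterWeight n ^ 6))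
      (fun n => mul_nonneg (hK0 n m) (hp0 n).le)
      (fun n => by
        refine (mul_le_mul_of_nonneg_right (abs_weightedHilbert_sub_le n m).2 (hp0 n).le).trans
          (le_of_eq ?_)
        have := quarterWeight_pos n
        simp only [hp]
        field_simp)
      (fun n => by
        refine (mul_le_mul_of_nonneg_right (abs_weightedHilbert_sub_le n m).1 (hp0 n).le).trans
          (le_of_eq ?_)
        have := quarterWeight_pos n
        simp only [hp]
        field_simp) L
    refine h.trans ?_
    rw [← mul_sum, ← mul_sum]
    have h1 := mul_le_mul_of_nonneg_left (sum_quarterWeight_inv_cube m)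
      (by positivity : 0 ≤ 2 / quarterWeight m ^ 3)
    have h2 : ∑ i ∈ range L, 1 / quarterWeight (m + 1 + i) ^ 6 ≤
        2 * (1 / quarterWeight m ^ 2) := by
      have := quarterWeight_pos (m + L)
      have h3 : 0 ≤ 1 / quarterWeight (m + L) ^ 2 := by positivity
      linarith [sum_quarterWeight_inv_pow_six m L]
    have h4 := mul_le_mul_of_nonneg_left h2 (by norm_num : (0 : ℝ) ≤ 2)
    refine (add_le_add h1 h4).trans (le_of_eq ?_)
    simp only [hp]
    field_simp
    norm_num
  have hschur := schur_test (range L) hK0 hp0 hrow hcol x y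
  have hhilb := abs_sum_div_sub_add_half_le (range L) x y
  have hsplit : ∑ n ∈ range L, ∑ m ∈ range L, weightedHilbert n m * x m * y n =
      ∑ n ∈ range L, ∑ m ∈ range L, 1 / ((n : ℝ) - m + 1 / 2) * x m * y n +
      ∑ n ∈ range L, ∑ m ∈ range L,
        (weightedHilbert n m - 1 / ((n : ℝ) - m + 1 / 2)) * x m * y n := by
    simp only [← sum_add_distrib]
    refine sum_congr rfl fun n _ => sum_congr rfl fun m _ => ?_
    ring
  have hdiff : |∑ n ∈ range L, ∑ m ∈ range L,
        (weightedHilbert n m - 1 / ((n : ℝ) - m + 1 / 2)) * x m * y n| ≤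
      ∑ n ∈ range L, ∑ m ∈ range L, K n m * |x m| * |y n| := by
    refine (abs_sum_le_sum_abs _ _).trans (sum_le_sum fun n _ => ?_)
    refine (abs_sum_le_sum_abs _ _).trans (sum_le_sum fun m _ => ?_)
    rw [abs_mul, abs_mul]
  have hsq : 0 ≤ ∑ m ∈ range L, x m ^ 2 + ∑ n ∈ range L, y n ^ 2 := by positivity
  rw [hsplit]
  refine (abs_add_le _ _).trans ?_
  -- The Hilbert and Schur parts add up to `(π + 12) / 2 ≤ 16 / 2`.
  nlinarith [Real.pi_lt_four]

/-- A bilinear form bounded on finite sequences is bounded on square summable ones. -/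
theorem sum_range_sq_le_of_bilinear_le {K : ℕ → ℕ → ℝ} {C : ℝ} (hC : 0 < C)
    (h : ∀ (L : ℕ) (x y : ℕ → ℝ), |∑ n ∈ range L, ∑ m ∈ range L, K n m * x m * y n| ≤
      C / 2 * (∑ m ∈ range L, x m ^ 2 + ∑ n ∈ range L, y n ^ 2))
    {x z : ℕ → ℝ} (hx : Summable fun m => x m ^ 2)
    (hz : ∀ n, HasSum (fun m => K n m * x m) (z n)) (L : ℕ) :
    ∑ n ∈ range L, z n ^ 2 ≤ C ^ 2 * ∑' m, x m ^ 2 := by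
  -- The form is tested on `y = z / C`, cut off at `L`. With `S = ∑ zₙ²` and `X = ∑ xₘ²` the limit
  -- reads `S / C ≤ (C / 2)(X + S / C²)`, and `S` can be absorbed.
  have h1 : ∀ᶠ M in atTop, ∑ n ∈ range L, (∑ m ∈ range M, K n m * x m) * (z n / C) ≤
      C / 2 * (∑' m, x m ^ 2 + ∑ n ∈ range L, (z n / C) ^ 2) := by
    filter_upwards [eventually_ge_atTop L] with M hM
    have h2 := (le_abs_self _).trans (h M x (fun n => if n ∈ range L then z n / C else 0))
    have hsub : range L ⊆ range M := range_subset_range.2 hM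
    have e1 : ∑ n ∈ range M, ∑ m ∈ range M, K n m * x m * (if n ∈ range L then z n / C else 0) =
        ∑ n ∈ range L, (∑ m ∈ range M, K n m * x m) * (z n / C) := by
      rw [← sum_subset hsub]
      · refine sum_congr rfl fun n hn => ?_
        rw [sum_mul]
        simp only [if_pos hn]
      · intro n _ hn
        simp only [if_neg hn, mul_zero, sum_const_zero]
    have e2 : ∑ n ∈ range M, (if n ∈ range L then z n / C else 0) ^ 2 =
        ∑ n ∈ range L, (z n / C) ^ 2 := by
      rw [← sum_subset hsub]
      · refine sum_congr rfl fun n hn => ?_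
        simp only [if_pos hn]
      · intro n _ hn
        rw [if_neg hn, zero_pow two_ne_zero]
    rw [e1, e2] at h2
    refine h2.trans ?_
    have := hx.sum_le_tsum (range M) fun m _ => sq_nonneg (x m)
    gcongr
  have h2 : Tendsto (fun M => ∑ n ∈ range L, (∑ m ∈ range M, K n m * x m) * (z n / C)) atTop
      (𝓝 (∑ n ∈ range L, z n * (z n / C))) :=
    tendsto_finsetSum _ fun n _ => (hz n).tendsto_sum_nat.mul_const _
  have h3 := le_of_tendsto h2 h1
  have e1 : ∑ n ∈ range L, z n * (z n / C) = (∑ n ∈ range L, z n ^ 2) / C := by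
    rw [sum_div]
    refine sum_congr rfl fun n _ => ?_
    ring
  have e2 : ∑ n ∈ range L, (z n / C) ^ 2 = (∑ n ∈ range L, z n ^ 2) / C ^ 2 := by
    rw [sum_div]
    refine sum_congr rfl fun n _ => ?_
    ring
  rw [e1, e2] at h3
  set S := ∑ n ∈ range L, z n ^ 2
  have e3 : C / 2 * (∑' m, x m ^ 2 + S / C ^ 2) = (C ^ 2 * ∑' m, x m ^ 2 + S) / (2 * C) := by
    field_simp
  rw [e3, div_le_div_iff₀ hC (by positivity)] at h3
  nlinarith

/-! ### Riesz projection and termwise integration on the circle -/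

theorem hasSum_rieszProj {F : ℂ → ℂ} (hF : CircleIntegrable F 0 1) {z : ℂ} (hz : ‖z‖ < 1) :
    HasSum (fun n : ℕ => circleCoeff F n * z ^ n) (rieszProj F z) := by
  have h := (hasSum_two_pi_I_cauchyPowerSeries_integral hF hz).mul_left
    (2 * (Real.pi : ℂ) * Complex.I)⁻¹
  have e : rieszProj F z = (2 * (Real.pi : ℂ) * Complex.I)⁻¹ *
      ∮ ζ in C(0, 1), (ζ - (0 + z))⁻¹ • F ζ := by
    rw [rieszProj]
    congr 2
    ext ζ
    rw [zero_add, smul_eq_mul, div_eq_inv_mul]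
  rw [e]
  refine h.congr_fun fun n => ?_
  rw [circleCoeff, mul_assoc, mul_comm _ (z ^ n), ← circleIntegral.integral_const_mul]
  congr 1
  refine circleIntegral.integral_congr zero_le_one fun ζ hζ => ?_
  have hζ0 : ζ ≠ 0 := by
    rintro rfl
    simp at hζ
  have h1 : (-((n : ℤ) + 1)) = -((n + 1 : ℕ) : ℤ) := by push_cast; ring
  simp only [smul_eq_mul, sub_zero]
  rw [h1, zpow_neg, zpow_natCast, div_pow, pow_succ]
  field_simp

theorem continuousOn_of_hasSum_zpow {g : ℕ → ℂ} {e : ℕ → ℤ} {G : ℂ → ℂ}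
    (hg : Summable fun m => ‖g m‖)
    (hG : ∀ ζ : ℂ, ‖ζ‖ = 1 → HasSum (fun m => g m * ζ ^ e m) (G ζ)) :
    ContinuousOn G (Metric.sphere 0 1) := by
  have h : ContinuousOn (fun ζ : ℂ => ∑' m, g m * ζ ^ e m) (Metric.sphere 0 1) := by
    refine continuousOn_tsum (fun m => ?_) hg fun m ζ hζ => ?_
    · refine continuousOn_const.mul fun ζ hζ => ?_
      refine (continuousAt_zpow₀ ζ (e m) (Or.inl ?_)).continuousWithinAt
      rintro rfl
      simp at hζ
    · rw [mem_sphere_zero_iff_norm] at hζ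
      simp [hζ]
  exact h.congr fun ζ hζ => (hG ζ (by simpa using hζ)).tsum_eq.symm

/-- An absolutely convergent expansion may be integrated term by term against an integrable
function. The free exponents `e` cover series in both `ζ` and `ζ⁻¹`. -/
theorem hasSum_circleCoeff_mul {g : ℕ → ℂ} {e : ℕ → ℤ} {G F : ℂ → ℂ}
    (hg : Summable fun m => ‖g m‖)
    (hG : ∀ ζ : ℂ, ‖ζ‖ = 1 → HasSum (fun m => g m * ζ ^ e m) (G ζ))
    (hF : CircleIntegrable F 0 1) (k : ℤ) :
    HasSum (fun m => g m * circleCoeff F (k - e m)) (circleCoeff (fun ζ => G ζ * F ζ) k) := by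
  have hnorm : ∀ θ, ‖circleMap 0 1 θ‖ = 1 := fun θ => by simp
  have hne : ∀ θ, circleMap 0 1 θ ≠ 0 := fun θ => circleMap_ne_center one_ne_zero
  have hcont : ∀ j : ℤ, Continuous fun θ => circleMap 0 1 θ ^ j := fun j => by
    simp only [circleMap_zero_one_zpow]
    fun_prop
  have h := intervalIntegral.hasSum_integral_of_dominated_convergence (μ := MeasureTheory.volume)
    (a := 0) (b := 2 * Real.pi)
    (F := fun m θ => g m * (circleMap 0 1 θ ^ (-(k - e m)) * F (circleMap 0 1 θ)))
    (f := fun θ => circleMap 0 1 θ ^ (-k) * (G (circleMap 0 1 θ) * F (circleMap 0 1 θ)))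
    (fun m θ => ‖g m‖ * ‖F (circleMap 0 1 θ)‖) (fun m => ?_) (fun m => ?_) ?_ ?_ ?_
  · simp only [circleCoeff_eq_intervalIntegral]
    refine (h.mul_left (2 * (Real.pi : ℂ))⁻¹).congr_fun fun m => ?_
    rw [intervalIntegral.integral_const_mul]
    ring
  · exact (((hcont _).aestronglyMeasurable).mul hF.def'.1).const_mul _
  · refine Eventually.of_forall fun θ _ => ?_
    simp [norm_zpow, hnorm]
  · exact Eventually.of_forall fun θ _ => hg.mul_right _
  · simp only [tsum_mul_right]
    exact hF.norm.const_mul _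
  · refine Eventually.of_forall fun θ _ => ?_
    have h1 := (hG _ (hnorm θ)).mul_left (circleMap 0 1 θ ^ (-k))
    have h2 := h1.mul_right (F (circleMap 0 1 θ))
    rw [mul_assoc] at h2
    refine h2.congr_fun fun m => ?_
    have : -(k - e m) = -k + e m := by ring
    rw [this, zpow_add₀ (hne θ)]
    ring

theorem circleCoeff_one (k : ℤ) : circleCoeff (fun _ => 1) k = if k = 0 then 1 else 0 := by
  have hpi : (Real.pi : ℂ) ≠ 0 := by exact_mod_cast Real.pi_ne_zero
  rw [circleCoeff_eq_intervalIntegral]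
  simp only [circleMap_zero_one_zpow, mul_one, integral_exp_int_mul_I, neg_eq_zero]
  split_ifs
  · field_simp
  · simp

theorem circleIntegrable_one_div_sqrt_neg :
    CircleIntegrable (fun ζ => 1 / Complex.sqrt (-ζ)) 0 1 := by
  rw [circleIntegrable_def]
  have h : Continuous fun θ : ℝ => Complex.I * Complex.exp (-(1 / 2) * Complex.I * θ) := by
    fun_prop
  refine (h.intervalIntegrable 0 (2 * Real.pi)).congr fun θ hθ => ?_
  rw [Set.uIoc_of_le (by positivity)] at hθ
  exact (one_div_sqrt_neg_circleMap hθ).symm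

/-! ### Integrability and Fourier coefficients of `1 / √(1 - ζ̄)` -/

theorem norm_sqrt (z : ℂ) : ‖Complex.sqrt z‖ = √‖z‖ := by
  have h : Complex.sqrt z ^ 2 = z := by
    rw [Complex.sqrt]
    exact Complex.cpow_nat_inv_pow z two_ne_zero
  rw [eq_comm, Real.sqrt_eq_iff_eq_sq (norm_nonneg _) (norm_nonneg _), ← norm_pow, h]

/-- One has `‖1 - e ^ (iθ)‖ = 2 sin (θ / 2) ≥ t / 4`, with `t` the distance to the nearer endpoint,
by Jordan's inequality. Adding the powers for both endpoints gives a single integrable majorant. -/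
theorem one_div_sqrt_norm_one_sub_circleMap_le {θ : ℝ} (hθ : θ ∈ Set.Ioo 0 (2 * Real.pi)) :
    1 / √‖1 - circleMap 0 1 θ‖ ≤
      2 * (θ ^ (-(1 / 2) : ℝ) + (2 * Real.pi - θ) ^ (-(1 / 2) : ℝ)) := by
  obtain ⟨h0, h1⟩ := hθ
  have hpi := Real.pi_pos
  have hpi4 := Real.pi_lt_four
  have hsin : 0 ≤ Real.sin (θ / 2) := Real.sin_nonneg_of_nonneg_of_le_pi (by linarith) (by linarith)
  have hn : ‖1 - circleMap 0 1 θ‖ = 2 * Real.sin (θ / 2) := by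
    have := Complex.norm_exp_I_mul_ofReal_sub_one θ
    rw [norm_sub_rev, circleMap, zero_add, Complex.ofReal_one, one_mul, mul_comm, this,
      Real.norm_eq_abs, abs_of_nonneg (by positivity)]
  have key : ∀ t : ℝ, 0 < t → t / 4 ≤ ‖1 - circleMap 0 1 θ‖ →
      1 / √‖1 - circleMap 0 1 θ‖ ≤ 2 * t ^ (-(1 / 2) : ℝ) := by
    intro t ht hle
    have h2 : √t / 2 ≤ √‖1 - circleMap 0 1 θ‖ := by
      refine (le_of_eq ?_).trans (Real.sqrt_le_sqrt hle)
      rw [Real.sqrt_div ht.le]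
      norm_num
    have h3 : 0 < √t := Real.sqrt_pos.2 ht
    rw [Real.rpow_neg ht.le, ← Real.sqrt_eq_rpow]
    calc 1 / √‖1 - circleMap 0 1 θ‖ ≤ 1 / (√t / 2) := by gcongr
      _ = 2 * (√t)⁻¹ := by field_simp
  have hlow : ∀ t : ℝ, 0 ≤ t → t ≤ Real.pi → t / 4 ≤ 2 * Real.sin (t / 2) := by
    intro t ht ht'
    have h2 := Real.mul_le_sin (x := t / 2) (by linarith) (by linarith)
    have h3 : t / 4 ≤ 2 * (2 / Real.pi * (t / 2)) := by
      have : 2 * (2 / Real.pi * (t / 2)) = 2 * t / Real.pi := by ring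
      rw [this, div_le_div_iff₀ (by norm_num) hpi]
      nlinarith
    linarith
  rcases le_total θ Real.pi with h | h
  · have h2 := key θ h0 (by rw [hn]; exact hlow θ h0.le h)
    have : 0 ≤ (2 * Real.pi - θ) ^ (-(1 / 2) : ℝ) := Real.rpow_nonneg (by linarith) _
    linarith
  · have h2 := key (2 * Real.pi - θ) (by linarith) (by
      rw [hn]
      have h3 := hlow (2 * Real.pi - θ) (by linarith) (by linarith)
      have h4 : (2 * Real.pi - θ) / 2 = Real.pi - θ / 2 := by ring
      rwa [h4, Real.sin_pi_sub] at h3)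
    have : 0 ≤ θ ^ (-(1 / 2) : ℝ) := Real.rpow_nonneg h0.le _
    linarith

theorem intervalIntegrable_rpow_endpoints :
    IntervalIntegrable (fun θ : ℝ => 2 * (θ ^ (-(1 / 2) : ℝ) + (2 * Real.pi - θ) ^ (-(1 / 2) : ℝ)))
      MeasureTheory.volume 0 (2 * Real.pi) := by
  have h1 : IntervalIntegrable (fun θ : ℝ => θ ^ (-(1 / 2) : ℝ)) MeasureTheory.volume 0
      (2 * Real.pi) := intervalIntegral.intervalIntegrable_rpow' (by norm_num)
  have h2 := (h1.comp_sub_left (2 * Real.pi)).symm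
  simp only [sub_zero, sub_self] at h2
  exact (h1.add h2).const_mul 2

theorem measurable_complex_sqrt : Measurable Complex.sqrt := by
  have : Complex.sqrt = fun z => z ^ (2⁻¹ : ℂ) := rfl
  rw [this]
  fun_prop

theorem ae_mem_Ioo_of_mem_uIoc {a b : ℝ} (hab : a ≤ b) {p : ℝ → Prop}
    (h : ∀ θ ∈ Set.Ioo a b, p θ) : ∀ᵐ θ, θ ∈ Set.uIoc a b → p θ := by
  have : ∀ᵐ θ : ℝ, θ ≠ b := by simp [MeasureTheory.ae_iff]
  filter_upwards [this] with θ hθ hmem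
  rw [Set.uIoc_of_le hab] at hmem
  exact h θ ⟨hmem.1, lt_of_le_of_ne hmem.2 hθ⟩

theorem circleIntegrable_one_div_sqrt_one_sub_conj :
    CircleIntegrable (fun ζ => 1 / Complex.sqrt (1 - conj ζ)) 0 1 := by
  rw [circleIntegrable_def]
  refine intervalIntegrable_rpow_endpoints.mono_fun' ?_ ?_
  · have h1 := measurable_complex_sqrt
    have h2 : Measurable fun θ => 1 - conj (circleMap 0 1 θ) :=
      measurable_const.sub (Complex.continuous_conj.measurable.comp (measurable_circleMap 0 1))
    exact (measurable_const.div (h1.comp h2)).aestronglyMeasurable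
  · rw [EventuallyLE, MeasureTheory.ae_restrict_iff' measurableSet_uIoc]
    refine ae_mem_Ioo_of_mem_uIoc (by positivity) fun θ hθ => ?_
    have h1 : 1 - conj (circleMap 0 1 θ) = conj (1 - circleMap 0 1 θ) := by simp
    rw [norm_div, norm_one, norm_sqrt, h1, RCLike.norm_conj]
    exact one_div_sqrt_norm_one_sub_circleMap_le hθ

theorem one_sub_ne_zero_of_mem_Ioo {θ : ℝ} (hθ : θ ∈ Set.Ioo 0 (2 * Real.pi)) :
    1 - circleMap 0 1 θ ≠ 0 := by
  have hsin : 0 < Real.sin (θ / 2) :=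
    Real.sin_pos_of_pos_of_lt_pi (by linarith [hθ.1]) (by linarith [hθ.2])
  have := Complex.norm_exp_I_mul_ofReal_sub_one θ
  rw [← norm_pos_iff, norm_sub_rev, circleMap, zero_add, Complex.ofReal_one, one_mul, mul_comm,
    this]
  simpa using hsin.ne'

theorem circleCoeff_one_div_sqrt_one_sub_conj_of_lt_one {r : ℝ} (h0 : 0 < r) (h1 : r < 1) (k : ℤ) :
    circleCoeff (fun ζ => 1 / Complex.sqrt (1 - r * conj ζ)) k =
      (invSqrtCoeffInt (-k) : ℂ) * (r : ℂ) ^ (-k).toNat := by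
  have hg : Summable fun m => ‖(invSqrtCoeff m : ℂ) * (r : ℂ) ^ m‖ := by
    refine Summable.of_nonneg_of_le (fun m => norm_nonneg _) (fun m => ?_)
      (summable_geometric_of_lt_one h0.le h1)
    rw [norm_mul, norm_pow, Complex.norm_real, Complex.norm_real, Real.norm_of_nonneg h0.le,
      Real.norm_of_nonneg (invSqrtCoeff_pos m).le]
    exact mul_le_of_le_one_left (by positivity) (invSqrtCoeff_le_one m)
  have hG : ∀ ζ : ℂ, ‖ζ‖ = 1 → HasSum (fun m : ℕ =>
      ((invSqrtCoeff m : ℂ) * (r : ℂ) ^ m) * ζ ^ (-(m : ℤ)))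
      (1 / Complex.sqrt (1 - r * conj ζ)) := by
    intro ζ hζ
    have h2 := hasSum_invSqrtCoeff (z := r * conj ζ) (by
      rw [norm_mul, RCLike.norm_conj, hζ, Complex.norm_real, Real.norm_of_nonneg h0.le, mul_one]
      exact h1)
    refine h2.congr_fun fun m => ?_
    rw [mul_pow, zpow_neg, zpow_natCast, ← Complex.inv_eq_conj hζ, inv_pow, mul_assoc]
  have h2 := hasSum_circleCoeff_mul hg hG (F := fun _ => 1)
    (circleIntegrable_const 1 0 1) k
  simp only [mul_one, circleCoeff_one, sub_neg_eq_add] at h2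
  refine h2.unique ?_
  rcases lt_or_ge 0 k with hk | hk
  · rw [invSqrtCoeffInt_of_neg (by lia)]
    simp only [Complex.ofReal_zero, zero_mul]
    refine hasSum_zero.congr_fun fun m => ?_
    rw [if_neg (by lia), mul_zero]
  · obtain ⟨m, hm⟩ := Int.eq_ofNat_of_zero_le (by lia : 0 ≤ -k)
    rw [hm, invSqrtCoeffInt_natCast, Int.toNat_natCast]
    convert hasSum_single m ?_ using 1
    · rw [if_pos (by lia), mul_one]
    · intro n hn
      rw [if_neg (by lia), mul_zero]

/-- The binomial series is not absolutely convergent on the circle itself, so the coefficients are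
computed at radius `r < 1` and passed to the limit by dominated convergence. -/
theorem circleCoeff_one_div_sqrt_one_sub_conj (k : ℤ) :
    circleCoeff (fun ζ => 1 / Complex.sqrt (1 - conj ζ)) k = (invSqrtCoeffInt (-k) : ℂ) := by
  have hnorm : ∀ θ, ‖circleMap 0 1 θ‖ = 1 := fun θ => by simp
  have hlt : ∀ᶠ r : ℝ in 𝓝[<] 1, 0 < r ∧ r < 1 := by
    filter_upwards [Ioo_mem_nhdsLT (show (0 : ℝ) < 1 by norm_num)] with r hr using hr
  have hcont : ∀ j : ℤ, Continuous fun θ => circleMap 0 1 θ ^ j := fun j => by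
    simp only [circleMap_zero_one_zpow]
    fun_prop
  have hlim1 : Tendsto (fun r : ℝ => circleCoeff (fun ζ => 1 / Complex.sqrt (1 - r * conj ζ)) k)
      (𝓝[<] 1) (𝓝 (circleCoeff (fun ζ => 1 / Complex.sqrt (1 - conj ζ)) k)) := by
    simp only [circleCoeff_eq_intervalIntegral]
    refine Tendsto.const_mul _ ?_
    refine intervalIntegral.tendsto_integral_filter_of_dominated_convergence
      (fun θ => 2 * (2 * (θ ^ (-(1 / 2) : ℝ) + (2 * Real.pi - θ) ^ (-(1 / 2) : ℝ)))) ?_ ?_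
      (intervalIntegrable_rpow_endpoints.const_mul 2) ?_
    · refine Eventually.of_forall fun r => ?_
      have h1 := measurable_complex_sqrt
      have h2 : Measurable fun θ => 1 - (r : ℂ) * conj (circleMap 0 1 θ) :=
        measurable_const.sub (measurable_const.mul
          (Complex.continuous_conj.measurable.comp (measurable_circleMap 0 1)))
      exact ((hcont _).measurable.mul (measurable_const.div (h1.comp h2))).aestronglyMeasurable
    · filter_upwards [hlt] with r hr
      refine ae_mem_Ioo_of_mem_uIoc (by positivity) fun θ hθ => ?_
      have h0 := norm_pos_iff.2 (one_sub_ne_zero_of_mem_Ioo hθ)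
      have h1 : 1 - (r : ℂ) * conj (circleMap 0 1 θ) = conj (1 - r * circleMap 0 1 θ) := by simp
      rw [norm_mul, norm_zpow, hnorm, one_zpow, one_mul, norm_div, norm_one, norm_sqrt, h1,
        RCLike.norm_conj]
      -- In fact `‖1 - ζ‖ ≤ ‖1 - rζ‖ + (1 - r) ≤ 2 ‖1 - rζ‖`; the weaker factor `4` has an exact
      -- square root.
      have h2 : ‖1 - circleMap 0 1 θ‖ / 4 ≤ ‖1 - r * circleMap 0 1 θ‖ := by
        have h3 : ‖1 - circleMap 0 1 θ‖ ≤
            ‖1 - r * circleMap 0 1 θ‖ + ‖(r - 1 : ℂ) * circleMap 0 1 θ‖ := by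
          refine (le_of_eq ?_).trans (norm_add_le _ _)
          congr 1
          ring
        have h4 : ‖(r - 1 : ℂ) * circleMap 0 1 θ‖ = 1 - r := by
          rw [norm_mul, hnorm, mul_one, ← Complex.ofReal_one, ← Complex.ofReal_sub,
            Complex.norm_real, Real.norm_of_nonpos (by linarith [hr.2])]
          ring
        have h5 : 1 - r ≤ ‖1 - r * circleMap 0 1 θ‖ := by
          have h6 := norm_sub_norm_le (1 : ℂ) (r * circleMap 0 1 θ)
          rwa [norm_one, norm_mul, hnorm, mul_one, Complex.norm_real,
            Real.norm_of_nonneg hr.1.le] at h6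
        linarith
      refine le_trans ?_ (mul_le_mul_of_nonneg_left (one_div_sqrt_norm_one_sub_circleMap_le hθ)
        zero_le_two)
      have h3 : √‖1 - circleMap 0 1 θ‖ / 2 ≤ √‖1 - r * circleMap 0 1 θ‖ := by
        refine (le_of_eq ?_).trans (Real.sqrt_le_sqrt h2)
        rw [Real.sqrt_div h0.le]
        norm_num
      have h4 : 0 < √‖1 - circleMap 0 1 θ‖ := Real.sqrt_pos.2 h0
      calc 1 / √‖1 - r * circleMap 0 1 θ‖ ≤ 1 / (√‖1 - circleMap 0 1 θ‖ / 2) := by gcongr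
        _ = 2 * (1 / √‖1 - circleMap 0 1 θ‖) := by field_simp
    · refine ae_mem_Ioo_of_mem_uIoc (by positivity) fun θ hθ => ?_
      refine Tendsto.const_mul _ (Tendsto.div tendsto_const_nhds ?_ ?_)
      · have h1 : ContinuousAt Complex.sqrt (1 - conj (circleMap 0 1 θ)) := by
          refine Complex.continuousAt_sqrt (Or.inl ?_)
          have := (Complex.re_le_norm (circleMap 0 1 θ)).trans_eq (hnorm θ)
          simp only [Complex.sub_re, Complex.one_re, Complex.conj_re]
          linarith
        refine h1.tendsto.comp ?_
        have h2 : Continuous fun r : ℝ => 1 - (r : ℂ) * conj (circleMap 0 1 θ) := by fun_prop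
        have h3 := (h2.tendsto 1).mono_left (nhdsWithin_le_nhds (s := Set.Iio 1))
        simpa using h3
      · have h1 : 1 - conj (circleMap 0 1 θ) = conj (1 - circleMap 0 1 θ) := by simp
        rw [← norm_pos_iff, norm_sqrt, Real.sqrt_pos, h1, RCLike.norm_conj, norm_pos_iff]
        exact one_sub_ne_zero_of_mem_Ioo hθ
  have hlim2 : Tendsto (fun r : ℝ => (invSqrtCoeffInt (-k) : ℂ) * (r : ℂ) ^ (-k).toNat)
      (𝓝[<] 1) (𝓝 (invSqrtCoeffInt (-k) : ℂ)) := by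
    have h2 : Continuous fun r : ℝ => (invSqrtCoeffInt (-k) : ℂ) * (r : ℂ) ^ (-k).toNat := by
      fun_prop
    have h3 := (h2.tendsto 1).mono_left (nhdsWithin_le_nhds (s := Set.Iio 1))
    simpa using h3
  refine tendsto_nhds_unique hlim1 (hlim2.congr' ?_)
  filter_upwards [hlt] with r hr
  exact (circleCoeff_one_div_sqrt_one_sub_conj_of_lt_one hr.1 hr.2 k).symm

/-! ### Toeplitz matrices on coefficient sequences -/

namespace HardySobolev

variable {r : ℝ}

theorem summable_norm_coeff (hr : 1 / 2 < r) (f : HardySobolev r) :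
    Summable fun m => ‖(f.coeff m : ℂ)‖ := by
  simpa using f.summable_abs_coeff hr

theorem hasSum_eval_zpow (hr : 1 / 2 < r) (f : HardySobolev r) (ζ : ℂ) (hζ : ‖ζ‖ = 1) :
    HasSum (fun m : ℕ => (f.coeff m : ℂ) * ζ ^ (m : ℤ)) (f.eval ζ) := by
  simpa using f.hasSum_eval hr hζ.le

theorem circleIntegrable_eval_mul (hr : 1 / 2 < r) (f : HardySobolev r) {F : ℂ → ℂ}
    (hF : CircleIntegrable F 0 1) : CircleIntegrable (fun ζ => f.eval ζ * F ζ) 0 1 := by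
  refine hF.continuousOn_mul ?_
  rw [abs_one]
  exact continuousOn_of_hasSum_zpow (f.summable_norm_coeff hr) (f.hasSum_eval_zpow hr)

/-- The Taylor coefficients of `P₊[f F]` are given by the Toeplitz matrix of `F`. -/
theorem isGenFun_rieszProj_eval_mul (hr : 1 / 2 < r) (f : HardySobolev r) {F : ℂ → ℂ}
    (hF : CircleIntegrable F 0 1) {c : ℤ → ℝ} (hc : ∀ k, circleCoeff F k = c k) {h : ℕ → ℝ}
    (hh : ∀ n : ℕ, HasSum (fun m : ℕ => f.coeff m * c (n - m)) (h n)) :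
    IsGenFun h (rieszProj fun ζ => f.eval ζ * F ζ) := by
  intro z hz
  refine (hasSum_rieszProj (f.circleIntegrable_eval_mul hr hF)
    (by simpa using hz)).congr_fun fun n => ?_
  congr 1
  have h1 := hasSum_circleCoeff_mul (f.summable_norm_coeff hr) (f.hasSum_eval_zpow hr) hF n
  simp only [hc] at h1
  refine HasSum.unique ?_ h1
  have h2 := Complex.hasSum_ofReal.2 (hh n)
  simpa using h2

end HardySobolev

/-- Multiplication of a summable sequence by the Toeplitz matrix of `1 / √(-ζ)`. -/
def halfHilbert (f : ℕ → ℝ) (n : ℕ) : ℝ :=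
  ∑' m : ℕ, f m * (1 / (Real.pi * (((n - m : ℤ) : ℝ) + 1 / 2)))

/-- The Taylor coefficients of `f(z) / √(1 - z)`. -/
def divSqrt (f : ℕ → ℝ) (n : ℕ) : ℝ := ∑' m : ℕ, f m * invSqrtCoeffInt (n - m)

/-- The Taylor coefficients of `P₊[g(ζ) / √(1 - ζ̄)]`. -/
def divSqrtConj (g : ℕ → ℝ) (n : ℕ) : ℝ := ∑' m : ℕ, g m * invSqrtCoeffInt (m - n)

theorem summable_mul_of_abs_le {f c : ℕ → ℝ} {C : ℝ} (hf : Summable fun m => |f m|)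
    (hc : ∀ m, |c m| ≤ C) : Summable fun m => f m * c m := by
  refine Summable.of_norm_bounded (hf.mul_right C) fun m => ?_
  rw [norm_mul, Real.norm_eq_abs, Real.norm_eq_abs]
  exact mul_le_mul_of_nonneg_left (hc m) (abs_nonneg _)

theorem half_le_abs_int_add_half (k : ℤ) : 1 / 2 ≤ |(k : ℝ) + 1 / 2| := by
  rcases lt_or_ge k 0 with h | h
  · have : (k : ℝ) ≤ -1 := by exact_mod_cast (by lia : k ≤ -1)
    rw [abs_of_neg (by linarith)]
    linarith
  · have : (0 : ℝ) ≤ k := by exact_mod_cast h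
    rw [abs_of_pos (by linarith)]
    linarith

theorem int_add_half_ne_zero (k : ℤ) : (k : ℝ) + 1 / 2 ≠ 0 := by
  have := half_le_abs_int_add_half k
  intro h
  rw [h, abs_zero] at this
  norm_num at this

theorem abs_one_div_pi_mul_le_one (k : ℤ) : |1 / (Real.pi * ((k : ℝ) + 1 / 2))| ≤ 1 := by
  have h := half_le_abs_int_add_half k
  have hpi := Real.pi_gt_three
  rw [abs_div, abs_one, abs_mul, abs_of_pos Real.pi_pos, div_le_one (by positivity)]
  nlinarith

theorem hasSum_halfHilbert {f : ℕ → ℝ} (hf : Summable fun m => |f m|) (n : ℕ) :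
    HasSum (fun m : ℕ => f m * (1 / (Real.pi * (((n - m : ℤ) : ℝ) + 1 / 2)))) (halfHilbert f n) :=
  (summable_mul_of_abs_le hf fun _ => abs_one_div_pi_mul_le_one _).hasSum

theorem hasSum_divSqrtConj {g : ℕ → ℝ} (hg : Summable fun m => |g m|) (n : ℕ) :
    HasSum (fun m : ℕ => g m * invSqrtCoeffInt (m - n)) (divSqrtConj g n) :=
  (summable_mul_of_abs_le hg fun _ => abs_invSqrtCoeffInt_le_one _).hasSum

theorem divSqrt_eq_coeff (f : ℕ → ℝ) (n : ℕ) :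
    divSqrt f n = PowerSeries.coeff n (PowerSeries.mk invSqrtCoeff * PowerSeries.mk f) := by
  rw [divSqrt, tsum_eq_sum (s := range (n + 1)), mul_comm, PowerSeries.coeff_mul,
    Nat.sum_antidiagonal_eq_sum_range_succ_mk]
  · refine sum_congr rfl fun m hm => ?_
    have h : (n : ℤ) - m = (n - m : ℕ) := by
      have := mem_range.1 hm
      lia
    rw [h, invSqrtCoeffInt_natCast]
    simp
  · intro m hm
    rw [invSqrtCoeffInt_of_neg, mul_zero]
    have := mem_range.not.1 hm
    lia

theorem mk_divSqrt (f : ℕ → ℝ) :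
    PowerSeries.mk (divSqrt f) = PowerSeries.mk invSqrtCoeff * PowerSeries.mk f := by
  ext n
  rw [PowerSeries.coeff_mk, divSqrt_eq_coeff]

theorem eq_zero_of_divSqrt_eq_zero {f : ℕ → ℝ} (h : divSqrt f = 0) : f = 0 := by
  have h1 := mk_divSqrt f
  rw [h] at h1
  have h2 : PowerSeries.mk f = 0 := by
    rw [← one_mul (PowerSeries.mk f), ← mk_sqrtCoeff_mul_mk_invSqrtCoeff, mul_assoc, ← h1]
    have : PowerSeries.mk (0 : ℕ → ℝ) = 0 := by
      ext n
      simp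
    rw [this, mul_zero]
  ext n
  simpa using congrArg (PowerSeries.coeff n) h2

/-- A summable sequence convolved with a null sequence is null. This puts `f / √(1 - z)` in the
class where the maximum principle applies. -/
theorem tendsto_divSqrt {f : ℕ → ℝ} (hf : Summable fun m => |f m|) :
    Tendsto (divSqrt f) atTop (𝓝 0) := by
  have h := tendsto_tsum_of_dominated_convergence (𝓕 := atTop)
    (f := fun (n : ℕ) (m : ℕ) => f m * invSqrtCoeffInt (n - m)) (g := fun _ => (0 : ℝ)) hf
    (fun m => ?_) (Eventually.of_forall fun n m => ?_)
  · rwa [tsum_zero] at h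
  · have h1 : Tendsto (fun n : ℕ => invSqrtCoeffInt (n - m)) atTop (𝓝 0) := by
      rw [← tendsto_add_atTop_iff_nat m]
      refine tendsto_invSqrtCoeff.congr fun n => ?_
      have : ((n + m : ℕ) : ℤ) - m = n := by push_cast; ring
      rw [this, invSqrtCoeffInt_natCast]
    simpa using h1.const_mul (f m)
  · rw [norm_mul, Real.norm_eq_abs, Real.norm_eq_abs]
    exact mul_le_of_le_one_right (abs_nonneg _) (abs_invSqrtCoeffInt_le_one _)

theorem tsum_sqrtCoeff_mul_tsum {f : ℕ → ℝ} (hf : Summable fun m => |f m|) {c : ℕ → ℕ → ℝ}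
    (hc : ∀ j m, |c j m| ≤ 1) :
    ∑' j, sqrtCoeff j * ∑' m, f m * c j m = ∑' m, f m * ∑' j, sqrtCoeff j * c j m := by
  have hs : Summable (Function.uncurry fun j m => sqrtCoeff j * (f m * c j m)) := by
    refine Summable.of_norm_bounded (summable_abs_sqrtCoeff.mul_of_nonneg hf
      (fun _ => abs_nonneg _) fun _ => abs_nonneg _) fun p => ?_
    simp only [Function.uncurry, norm_mul, Real.norm_eq_abs]
    gcongr
    exact mul_le_of_le_one_right (abs_nonneg _) (hc _ _)
  simp only [← tsum_mul_left]
  refine hs.tsum_comm.symm.trans ?_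
  refine tsum_congr fun m => tsum_congr fun j => ?_
  ring

/-- The factorization of `𝒜`: division by `√(1 - z)`, followed by the Toeplitz operator with symbol
`√(1 - ζ̄)`. -/
theorem tsum_sqrtCoeff_mul_divSqrt {f : ℕ → ℝ} (hf : Summable fun m => |f m|) (n : ℕ) :
    ∑' j, sqrtCoeff j * divSqrt f (n + j) = halfHilbert f n := by
  have h := tsum_sqrtCoeff_mul_tsum hf (c := fun j m => invSqrtCoeffInt (j + (n - m)))
    fun _ _ => abs_invSqrtCoeffInt_le_one _
  simp only [(hasSum_sqrtCoeff_mul_invSqrtCoeffInt _).tsum_eq] at h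
  rw [halfHilbert, ← h]
  refine tsum_congr fun j => ?_
  rw [divSqrt]
  congr 1
  refine tsum_congr fun m => ?_
  congr 2
  push_cast
  ring

theorem tsum_sqrtCoeff_mul_invSqrtCoeffInt_sub (k : ℤ) :
    ∑' j : ℕ, sqrtCoeff j * invSqrtCoeffInt (k - j) = if k = 0 then 1 else 0 := by
  rcases lt_or_ge k 0 with hk | hk
  · rw [if_neg hk.ne]
    refine (tsum_congr fun j => ?_).trans tsum_zero
    rw [invSqrtCoeffInt_of_neg (by lia), mul_zero]
  · obtain ⟨n, rfl⟩ := Int.eq_ofNat_of_zero_le hk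
    have h := divSqrt_eq_coeff sqrtCoeff n
    rw [mul_comm (PowerSeries.mk _), mk_sqrtCoeff_mul_mk_invSqrtCoeff, PowerSeries.coeff_one] at h
    rw [divSqrt] at h
    rw [h]
    simp

/-- Toeplitz operators with coanalytic symbols multiply like their symbols, so `√(1 - ζ̄)` undoes `1
/ √(1 - ζ̄)`. -/
theorem tsum_sqrtCoeff_mul_divSqrtConj {g : ℕ → ℝ} (hg : Summable fun m => |g m|) (n : ℕ) :
    ∑' j, sqrtCoeff j * divSqrtConj g (n + j) = g n := by
  have h := tsum_sqrtCoeff_mul_tsum hg (c := fun j m => invSqrtCoeffInt ((m - n : ℤ) - j))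
    fun _ _ => abs_invSqrtCoeffInt_le_one _
  simp only [tsum_sqrtCoeff_mul_invSqrtCoeffInt_sub] at h
  have h1 : ∑' m : ℕ, g m * (if (m - n : ℤ) = 0 then 1 else 0) = g n := by
    rw [tsum_eq_single n]
    · simp
    · intro m hm
      rw [if_neg (by lia), mul_zero]
  rw [← h1, ← h]
  refine tsum_congr fun j => ?_
  rw [divSqrtConj]
  congr 1
  refine tsum_congr fun m => ?_
  congr 2
  push_cast
  ring

/-! ### Injectivity and the formula for the inverse -/

/-- A maximum principle: the Toeplitz operator with symbol `√(1 - ζ̄)` is injective on null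
sequences. -/
theorem eq_zero_of_tsum_sqrtCoeff_mul_eq_zero {h : ℕ → ℝ} (h0 : Tendsto h atTop (𝓝 0))
    (hA : ∀ n, ∑' j, sqrtCoeff j * h (n + j) = 0) : h = 0 := by
  by_contra hne
  obtain ⟨n₁, hn₁⟩ := Function.ne_iff.1 hne
  have habs : Tendsto (fun n => |h n|) atTop (𝓝 0) := by simpa using h0.abs
  have hev := habs.eventually_lt_const (abs_pos.2 hn₁)
  obtain ⟨N, hN⟩ := eventually_atTop.1 hev
  -- The range contains `n₁`, and beyond it all values are below `|h n₁|`, so the maximum is global.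
  obtain ⟨n₀, hn₀, hmax⟩ := exists_max_image (range (N + n₁ + 1)) (fun n => |h n|)
    ⟨n₁, mem_range.2 (by lia)⟩
  set M := |h n₀| with hM
  have hle₁ : |h n₁| ≤ M := hmax n₁ (mem_range.2 (by lia))
  have hMpos : 0 < M := (abs_pos.2 hn₁).trans_le hle₁
  have hbound : ∀ n, |h n| ≤ M := by
    intro n
    rcases lt_or_ge n (N + n₁ + 1) with hn | hn
    · exact hmax n (mem_range.2 hn)
    · exact ((hN n (by lia)).trans_le hle₁).le
  -- The equation writes `h n` as an average of later values with total mass `1`, of which `1/2`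
  -- sits at `n + 1`. A maximum at `n` therefore forces one at `n + 1`, and then forever, against
  -- the decay of `h`.
  have hstep : ∀ n, |h n| = M → |h (n + 1)| = M := by
    intro n hn
    refine le_antisymm (hbound _) ?_
    have hs : Summable fun j => sqrtCoeff j * h (n + j) :=
      summable_mul_of_abs_le summable_abs_sqrtCoeff fun j => hbound _
    have h1 := hA n
    rw [hs.tsum_eq_zero_add, sqrtCoeff_zero, one_mul, add_zero] at h1
    have hs1 := (summable_nat_add_iff 1).2 hs
    rw [hs1.tsum_eq_zero_add] at h1
    have hs2 := (summable_nat_add_iff 1).2 hs1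
    have ha1 := hasSum_abs_sqrtCoeff_succ.summable.tsum_eq_zero_add
    rw [hasSum_abs_sqrtCoeff_succ.tsum_eq] at ha1
    simp only [zero_add, sqrtCoeff_one] at h1 ha1
    have ha2 : ∑' j, |sqrtCoeff (j + 1 + 1)| = 1 / 2 := by
      rw [abs_of_neg (by norm_num)] at ha1
      linarith
    have hsa := ((summable_nat_add_iff 2).2 summable_abs_sqrtCoeff).mul_right M
    have h3 : |∑' j, sqrtCoeff (j + 1 + 1) * h (n + (j + 1 + 1))| ≤ 1 / 2 * M := by
      rw [← ha2, ← tsum_mul_right, ← Real.norm_eq_abs]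
      refine tsum_of_norm_bounded hsa.hasSum fun j => ?_
      rw [norm_mul, Real.norm_eq_abs, Real.norm_eq_abs]
      exact mul_le_mul_of_nonneg_left (hbound _) (abs_nonneg _)
    have h4 : |h n| ≤ 1 / 2 * |h (n + 1)| + 1 / 2 * M := by
      have h5 : h n = 1 / 2 * h (n + 1) -
          ∑' j, sqrtCoeff (j + 1 + 1) * h (n + (j + 1 + 1)) := by linarith
      rw [h5]
      have h6 := abs_sub_le (1 / 2 * h (n + 1)) 0
        (∑' j, sqrtCoeff (j + 1 + 1) * h (n + (j + 1 + 1)))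
      rw [sub_zero, zero_sub, abs_neg] at h6
      refine h6.trans ?_
      rw [abs_mul, abs_of_pos (by norm_num : (0 : ℝ) < 1 / 2)]
      linarith
    linarith
  have hall : ∀ k, |h (n₀ + k)| = M := by
    intro k
    induction k with
    | zero => rfl
    | succ k ih => exact hstep _ ih
  have h2 : |h (n₀ + N)| < |h n₁| := hN _ (by lia)
  rw [hall] at h2
  linarith

theorem eq_zero_of_halfHilbert_eq_zero {f : ℕ → ℝ} (hf : Summable fun m => |f m|)
    (h : halfHilbert f = 0) : f = 0 := by
  refine eq_zero_of_divSqrt_eq_zero (eq_zero_of_tsum_sqrtCoeff_mul_eq_zero (tendsto_divSqrt hf)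
    fun n => ?_)
  rw [tsum_sqrtCoeff_mul_divSqrt hf, h, Pi.zero_apply]

/-- The Taylor coefficients of `√(1 - z) P₊[g(ζ) / √(1 - ζ̄)]`. -/
def halfHilbertInv (g : ℕ → ℝ) (n : ℕ) : ℝ :=
  PowerSeries.coeff n (PowerSeries.mk sqrtCoeff * PowerSeries.mk (divSqrtConj g))

theorem divSqrt_halfHilbertInv (g : ℕ → ℝ) : divSqrt (halfHilbertInv g) = divSqrtConj g := by
  ext n
  rw [divSqrt_eq_coeff]
  have : PowerSeries.mk (halfHilbertInv g) =
      PowerSeries.mk sqrtCoeff * PowerSeries.mk (divSqrtConj g) := by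
    ext n
    rw [PowerSeries.coeff_mk, halfHilbertInv]
  rw [this, ← mul_assoc, mul_comm (PowerSeries.mk invSqrtCoeff), mk_sqrtCoeff_mul_mk_invSqrtCoeff,
    one_mul, PowerSeries.coeff_mk]

theorem halfHilbert_halfHilbertInv {g : ℕ → ℝ} (hg : Summable fun m => |g m|)
    (hf : Summable fun m => |halfHilbertInv g m|) : halfHilbert (halfHilbertInv g) = g := by
  ext n
  rw [← tsum_sqrtCoeff_mul_divSqrt hf, divSqrt_halfHilbertInv, tsum_sqrtCoeff_mul_divSqrtConj hg]

/-- These are the matrix entries of `g ↦ √(1 - z) P₊[g / √(1 - ζ̄)]`. Raising `n` and `m` together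
keeps `m - n` and adds one summand, so the closed form follows by induction along diagonals. -/
theorem sum_range_sqrtCoeff_mul_invSqrtCoeffInt (n m : ℕ) :
    ∑ k ∈ range (n + 1), sqrtCoeff k * invSqrtCoeffInt (m - n + k) =
      (m + 1 / 2) * invSqrtCoeff n * invSqrtCoeff m / (m - n + 1 / 2) := by
  induction n generalizing m with
  | zero =>
    have : (m + 1 / 2 : ℝ) ≠ 0 := by positivity
    simp [sqrtCoeff_zero, invSqrtCoeff_zero, invSqrtCoeffInt_natCast]
    field_simp
  | succ n ih =>
    rw [sum_range_succ]
    have e1 : (m : ℤ) - (n + 1 : ℕ) + (n + 1 : ℕ) = m := by ring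
    rw [e1, invSqrtCoeffInt_natCast]
    cases m with
    | zero =>
      rw [sum_eq_zero]
      · have h := one_sub_two_mul_ne_zero (n + 1)
        have h' : ((0 : ℕ) : ℝ) - (n + 1 : ℕ) + 1 / 2 = (1 - 2 * (n + 1 : ℕ)) / 2 := by
          push_cast
          ring
        rw [h', sqrtCoeff, invSqrtCoeff_zero]
        field_simp
        simp
      · intro k hk
        rw [invSqrtCoeffInt_of_neg, mul_zero]
        have := mem_range.1 hk
        push_cast
        lia
    | succ m =>
      have e2 : ((m + 1 : ℕ) : ℤ) - (n + 1 : ℕ) = m - n := by push_cast; ring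
      rw [e2, ih m]
      have h1 := one_sub_two_mul_ne_zero (n + 1)
      have h2 := int_add_half_ne_zero (m - n)
      rw [sqrtCoeff, invSqrtCoeff_succ n, invSqrtCoeff_succ m]
      push_cast at h1 h2 ⊢
      have e3 : ((m : ℝ) + 1 - (n + 1) + 1 / 2) = m - n + 1 / 2 := by ring
      rw [e3]
      generalize invSqrtCoeff n = p
      generalize invSqrtCoeff m = q
      have h3 : (2 * n + 2 : ℝ) ≠ 0 := by positivity
      have h4 : (2 * m + 2 : ℝ) ≠ 0 := by positivity
      have h5 : (2 * n + 1 : ℝ) ≠ 0 := by positivity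
      have e4 : p * ((2 * n + 1) / (2 * n + 2)) / (1 - 2 * (n + 1)) = -(p / (2 * n + 2)) := by
        have e5 : (1 - 2 * ((n : ℝ) + 1)) = -(2 * n + 1) := by ring
        rw [e5]
        field_simp
      rw [e4, div_add' _ _ _ h2, div_left_inj' h2]
      field_simp
      ring

theorem hasSum_halfHilbertInv {g : ℕ → ℝ} (hg : Summable fun m => |g m|) (n : ℕ) :
    HasSum (fun m : ℕ => (m + 1 / 2) * invSqrtCoeff n * invSqrtCoeff m / (m - n + 1 / 2) * g m)
      (halfHilbertInv g n) := by
  have h : HasSum (fun m : ℕ => ∑ k ∈ range (n + 1),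
      sqrtCoeff k * (g m * invSqrtCoeffInt (m - (n - k : ℕ)))) (halfHilbertInv g n) := by
    rw [halfHilbertInv, PowerSeries.coeff_mul, Nat.sum_antidiagonal_eq_sum_range_succ_mk]
    refine hasSum_sum fun k _ => ?_
    simp only [PowerSeries.coeff_mk]
    exact (hasSum_divSqrtConj hg (n - k)).mul_left _
  refine h.congr_fun fun m => ?_
  rw [← sum_range_sqrtCoeff_mul_invSqrtCoeffInt, sum_mul]
  refine sum_congr rfl fun k hk => ?_
  have h1 : (m : ℤ) - n + k = m - (n - k : ℕ) := by
    have := mem_range.1 hk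
    lia
  rw [h1]
  ring

/-! ### Norm bounds in `H²_{3/4}` -/

theorem rpow_eq_quarterWeight_pow (n : ℕ) :
    (1 + (n : ℝ)) ^ (2 * (3 / 4) : ℝ) = quarterWeight n ^ 6 := by
  have h : (0 : ℝ) ≤ 1 + n := by positivity
  rw [quarterWeight, ← Real.rpow_natCast, ← Real.rpow_mul h]
  norm_num

theorem abs_sum_weightedHilbert_transpose_le (L : ℕ) (x y : ℕ → ℝ) :
    |∑ n ∈ range L, ∑ m ∈ range L, weightedHilbert m n * x m * y n| ≤
      16 / 2 * (∑ m ∈ range L, x m ^ 2 + ∑ n ∈ range L, y n ^ 2) := by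
  have h := abs_sum_weightedHilbert_le L y x
  rw [sum_comm, add_comm] at h
  refine (le_of_eq ?_).trans h
  congr 1
  refine sum_congr rfl fun n _ => sum_congr rfl fun m _ => ?_
  ring

namespace HardySobolev

theorem summable_weight_sq (f : HardySobolev (3 / 4)) :
    Summable fun n => quarterWeight n ^ 6 * f.coeff n ^ 2 := by
  simpa only [rpow_eq_quarterWeight_pow, sq_abs] using f.summable_coeff

theorem norm_sq_eq (f : HardySobolev (3 / 4)) :
    ‖f‖ ^ 2 = ∑' n, quarterWeight n ^ 6 * f.coeff n ^ 2 := by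
  have h0 : 0 ≤ ∑' n, quarterWeight n ^ 6 * f.coeff n ^ 2 := tsum_nonneg fun n => by
    have := quarterWeight_pos n
    positivity
  rw [norm_eq]
  simp only [rpow_eq_quarterWeight_pow, sq_abs]
  rw [Real.sq_sqrt h0]

/-- The element of `H²_{3/4}` with given Taylor coefficients. -/
def ofCoeff (c : ℕ → ℝ) (hc : Summable fun n => quarterWeight n ^ 6 * c n ^ 2) :
    HardySobolev (3 / 4) :=
  (⟨c, by
    change Summable _
    simpa only [rpow_eq_quarterWeight_pow, sq_abs] using hc⟩ : ↥(weightedL2 (3 / 4)))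

@[simp] theorem coeff_ofCoeff (c : ℕ → ℝ) (hc : Summable fun n => quarterWeight n ^ 6 * c n ^ 2) :
    (ofCoeff c hc).coeff = c := rfl

theorem summable_abs (f : HardySobolev (3 / 4)) : Summable fun n => |f.coeff n| :=
  f.summable_abs_coeff (by norm_num)

theorem eval_one (f : HardySobolev (3 / 4)) : f.eval 1 = ((∑' n, f.coeff n : ℝ) : ℂ) := by
  simp [eval, Complex.ofReal_tsum]

/-- Up to the contribution of the value at `1`, the operator `𝒜` is bounded on `H²_{3/4}`. -/
theorem sum_range_halfHilbert_sub_sq_le (f : HardySobolev (3 / 4)) (L : ℕ) :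
    ∑ n ∈ range L, (((n + 1 / 2) * Real.pi * halfHilbert f.coeff n - ∑' m, f.coeff m) /
      quarterWeight n) ^ 2 ≤ 16 ^ 2 * ‖f‖ ^ 2 := by
  set x : ℕ → ℝ := fun m => m * f.coeff m / quarterWeight m with hx
  have hle : ∀ m, x m ^ 2 ≤ quarterWeight m ^ 6 * f.coeff m ^ 2 := by
    intro m
    have hw := quarterWeight_pos m
    have h4 := quarterWeight_pow_four m
    have h8 : (m : ℝ) ^ 2 ≤ quarterWeight m ^ 8 := by
      have : quarterWeight m ^ 8 = (1 + m : ℝ) ^ 2 := by rw [← h4]; ring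
      rw [this]
      have := m.cast_nonneg (α := ℝ)
      gcongr
      linarith
    simp only [hx]
    rw [div_pow, mul_pow, div_le_iff₀ (by positivity)]
    nlinarith [mul_le_mul_of_nonneg_right h8 (sq_nonneg (f.coeff m))]
  have hxs : Summable fun m => x m ^ 2 :=
    Summable.of_nonneg_of_le (fun m => sq_nonneg _) hle f.summable_weight_sq
  have hz : ∀ n, HasSum (fun m => weightedHilbert n m * x m)
      (((n + 1 / 2) * Real.pi * halfHilbert f.coeff n - ∑' m, f.coeff m) / quarterWeight n) := by
    intro n
    have h1 := (hasSum_halfHilbert f.summable_abs n).mul_left ((n + 1 / 2) * Real.pi)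
    have h2 := (h1.sub f.summable_abs.of_abs.hasSum).div_const (quarterWeight n)
    refine h2.congr_fun fun m => ?_
    have hw := quarterWeight_pos m
    have hn := quarterWeight_pos n
    have h3 := int_add_half_ne_zero (n - m)
    have hpi := Real.pi_pos
    simp only [hx, weightedHilbert]
    push_cast at h3 ⊢
    -- This is `(n + 1/2) / (n - m + 1/2) - 1 = m / (n - m + 1/2)`, the identity that moves the
    -- weight from `n` to `m` and isolates the value at `1`.
    have e : ((n : ℝ) + 1 / 2) * Real.pi * (f.coeff m * (1 / (Real.pi * (n - m + 1 / 2)))) -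
        f.coeff m = m * f.coeff m / (n - m + 1 / 2) := by
      rw [eq_div_iff h3, sub_mul]
      generalize hd : (n - m + 1 / 2 : ℝ) = d at h3
      have h4 : (n : ℝ) + 1 / 2 = d + m := by linarith
      rw [h4]
      field_simp
      ring
    rw [e]
    field_simp
  refine (sum_range_sq_le_of_bilinear_le (by norm_num) abs_sum_weightedHilbert_le hxs hz L).trans ?_
  rw [norm_sq_eq]
  exact mul_le_mul_of_nonneg_left (hxs.tsum_le_tsum hle f.summable_weight_sq) (by norm_num)

theorem sum_range_halfHilbert_le (f : HardySobolev (3 / 4)) (hf : ∑' m, f.coeff m = 0) (L : ℕ) :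
    ∑ n ∈ range L, quarterWeight n ^ 6 * halfHilbert f.coeff n ^ 2 ≤ 16 ^ 2 * ‖f‖ ^ 2 := by
  refine le_trans (sum_le_sum fun n _ => ?_) (f.sum_range_halfHilbert_sub_sq_le L)
  have hw := quarterWeight_pos n
  have h4 := quarterWeight_pow_four n
  have hn := n.cast_nonneg (α := ℝ)
  have h8 : quarterWeight n ^ 8 ≤ ((n + 1 / 2) * Real.pi) ^ 2 := by
    have : quarterWeight n ^ 8 = (1 + n : ℝ) ^ 2 := by rw [← h4]; ring
    rw [this]
    gcongr
    nlinarith [Real.pi_gt_three]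
  rw [hf, sub_zero, div_pow, mul_pow _ (halfHilbert f.coeff n), le_div_iff₀ (by positivity)]
  nlinarith [mul_le_mul_of_nonneg_right h8 (sq_nonneg (halfHilbert f.coeff n))]

theorem sum_range_halfHilbertInv_le (g : HardySobolev (3 / 4)) (L : ℕ) :
    ∑ n ∈ range L, quarterWeight n ^ 6 * halfHilbertInv g.coeff n ^ 2 ≤ 16 ^ 2 * ‖g‖ ^ 2 := by
  -- The factor multiplying `g.coeff m` is of order `m ^ (3/4)`, since `invSqrtCoeff m` is of order
  -- `m ^ (-1/2)`; on the output side `quarterWeight n / invSqrtCoeff n` has the same order in `n`.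
  set x : ℕ → ℝ := fun m => quarterWeight m * invSqrtCoeff m * (m + 1 / 2) * g.coeff m with hx
  have hle : ∀ m, x m ^ 2 ≤ quarterWeight m ^ 6 * g.coeff m ^ 2 := by
    intro m
    have hw := quarterWeight_pos m
    have h4 := quarterWeight_pow_four m
    have hm := m.cast_nonneg (α := ℝ)
    have hb := invSqrtCoeff_sq_mul_le m
    have h5 : invSqrtCoeff m ^ 2 * (m + 1 / 2) ^ 2 ≤ quarterWeight m ^ 4 := by
      rw [h4]
      nlinarith [mul_le_mul_of_nonneg_right hb (by positivity : 0 ≤ ((m : ℝ) + 1 / 2) / 2)]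
    have e : x m ^ 2 = (invSqrtCoeff m ^ 2 * (m + 1 / 2) ^ 2) *
        (quarterWeight m ^ 2 * g.coeff m ^ 2) := by
      simp only [hx]
      ring
    rw [e]
    refine (mul_le_mul_of_nonneg_right h5 (by positivity)).trans (le_of_eq ?_)
    ring
  have hxs : Summable fun m => x m ^ 2 :=
    Summable.of_nonneg_of_le (fun m => sq_nonneg _) hle g.summable_weight_sq
  have hz : ∀ n, HasSum (fun m => weightedHilbert m n * x m)
      (quarterWeight n / invSqrtCoeff n * halfHilbertInv g.coeff n) := by
    intro n
    refine ((hasSum_halfHilbertInv g.summable_abs n).mul_left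
      (quarterWeight n / invSqrtCoeff n)).congr_fun fun m => ?_
    have hw := quarterWeight_pos m
    have hn := quarterWeight_pos n
    have hb := invSqrtCoeff_pos n
    simp only [hx, weightedHilbert]
    field_simp
  refine le_trans (sum_le_sum fun n _ => ?_)
    ((sum_range_sq_le_of_bilinear_le (by norm_num) abs_sum_weightedHilbert_transpose_le hxs hz
      L).trans ?_)
  · have hw := quarterWeight_pos n
    have hb := invSqrtCoeff_pos n
    have h4 := quarterWeight_pow_four n
    have h5 : quarterWeight n ^ 4 * invSqrtCoeff n ^ 2 ≤ 1 := by
      rw [h4]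
      have := invSqrtCoeff_sq_mul_le n
      nlinarith [mul_nonneg (sq_nonneg (invSqrtCoeff n)) (n.cast_nonneg (α := ℝ))]
    have e : quarterWeight n ^ 6 * halfHilbertInv g.coeff n ^ 2 =
        (quarterWeight n ^ 4 * invSqrtCoeff n ^ 2) *
          (quarterWeight n / invSqrtCoeff n * halfHilbertInv g.coeff n) ^ 2 := by
      field_simp
    rw [e]
    exact mul_le_of_le_one_left (sq_nonneg _) h5
  · rw [norm_sq_eq]
    exact mul_le_mul_of_nonneg_left (hxs.tsum_le_tsum hle g.summable_weight_sq) (by norm_num)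

theorem summable_of_sum_range_weight_le {c : ℕ → ℝ} {C : ℝ}
    (h : ∀ L, ∑ n ∈ range L, quarterWeight n ^ 6 * c n ^ 2 ≤ C) :
    Summable fun n => quarterWeight n ^ 6 * c n ^ 2 :=
  summable_of_sum_range_le (fun n => by have := quarterWeight_pos n; positivity) h

theorem norm_ofCoeff_le {c : ℕ → ℝ} {C : ℝ} (hC : 0 ≤ C)
    (h : ∀ L, ∑ n ∈ range L, quarterWeight n ^ 6 * c n ^ 2 ≤ 16 ^ 2 * C ^ 2) :
    ‖ofCoeff c (summable_of_sum_range_weight_le h)‖ ≤ 16 * C := by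
  refine le_of_sq_le_sq ?_ (by positivity)
  rw [norm_sq_eq, mul_pow]
  exact Real.tsum_le_of_sum_range_le
    (fun n => by have := quarterWeight_pos n; positivity) h

/-- `g ↦ √(1 - z) P₊[g(ζ) / √(1 - ζ̄)]` -/
def inverseA (g : HardySobolev (3 / 4)) : HardySobolev (3 / 4) :=
  ofCoeff (halfHilbertInv g.coeff) (summable_of_sum_range_weight_le g.sum_range_halfHilbertInv_le)

theorem norm_inverseA_le (g : HardySobolev (3 / 4)) : ‖inverseA g‖ ≤ 16 * ‖g‖ :=
  norm_ofCoeff_le (norm_nonneg g) g.sum_range_halfHilbertInv_le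

theorem halfHilbert_inverseA (g : HardySobolev (3 / 4)) :
    halfHilbert (inverseA g).coeff = g.coeff :=
  halfHilbert_halfHilbertInv g.summable_abs (inverseA g).summable_abs

/-- With `f = 𝒜⁻¹ g`, both `(n + 1/2) π gₙ - f(1)` and `(n + 1/2) π gₙ` are square summable against
`(1 + n) ^ (-1/4)`. So is the constant `f(1)`, and it must be `0` because `∑ (1 + n) ^ (-1/2)`
diverges. -/
theorem tsum_coeff_inverseA (g : HardySobolev (3 / 4)) : ∑' m, (inverseA g).coeff m = 0 := by
  set S := ∑' m, (inverseA g).coeff m with hS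
  by_contra hne
  have h1 : Summable fun n : ℕ =>
      (((n + 1 / 2) * Real.pi * g.coeff n - S) / quarterWeight n) ^ 2 := by
    have h := (inverseA g).sum_range_halfHilbert_sub_sq_le
    rw [halfHilbert_inverseA] at h
    exact summable_of_sum_range_le (fun n => sq_nonneg _) h
  have h2 : Summable fun n : ℕ => ((n + 1 / 2) * Real.pi * g.coeff n / quarterWeight n) ^ 2 := by
    refine Summable.of_nonneg_of_le (fun n => sq_nonneg _) (fun n => ?_)
      (g.summable_weight_sq.mul_left (Real.pi ^ 2))
    have hw := quarterWeight_pos n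
    have h4 := quarterWeight_pow_four n
    have hn := n.cast_nonneg (α := ℝ)
    have h8 : ((n : ℝ) + 1 / 2) ^ 2 ≤ quarterWeight n ^ 8 := by
      have : quarterWeight n ^ 8 = (1 + n : ℝ) ^ 2 := by rw [← h4]; ring
      rw [this]
      exact pow_le_pow_left₀ (by positivity) (by linarith) 2
    rw [div_pow, div_le_iff₀ (by positivity)]
    have h9 := mul_le_mul_of_nonneg_right h8
      (by positivity : 0 ≤ Real.pi ^ 2 * g.coeff n ^ 2)
    nlinarith
  have h3 : Summable fun n : ℕ => 1 / quarterWeight n ^ 2 := by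
    refine Summable.of_nonneg_of_le (fun n => by positivity) (fun n => ?_)
      ((h1.add h2).mul_left (2 / S ^ 2))
    have hw := quarterWeight_pos n
    have e : 1 / quarterWeight n ^ 2 = 1 / S ^ 2 * (S / quarterWeight n) ^ 2 := by
      field_simp
    have e2 : 2 / S ^ 2 = 1 / S ^ 2 * 2 := by ring
    rw [e, e2, mul_assoc]
    refine mul_le_mul_of_nonneg_left ?_ (by positivity)
    rw [sub_div]
    generalize (n + 1 / 2 : ℝ) * Real.pi * g.coeff n / quarterWeight n = u
    nlinarith [sq_nonneg (2 * u - S / quarterWeight n)]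
  -- Comparison with the harmonic series suffices for the contradiction.
  have h4 : Summable fun n : ℕ => 1 / ((n + 1 : ℕ) : ℝ) := by
    refine Summable.of_nonneg_of_le (fun n => by positivity) (fun n => ?_) h3
    have hw := quarterWeight_pos n
    have h4 := quarterWeight_pow_four n
    have h5 : 1 ≤ quarterWeight n ^ 2 := by
      have := quarterWeight_mono n.zero_le
      rw [quarterWeight_zero] at this
      nlinarith
    refine one_div_le_one_div_of_le (by positivity) ?_
    push_cast
    nlinarith
  exact Real.not_summable_one_div_natCast
    ((summable_nat_add_iff (f := fun n : ℕ => 1 / (n : ℝ)) 1).1 h4)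

/-! ### From coefficient sequences to generating functions -/

theorem isGenFun_opA (f : HardySobolev (3 / 4)) : IsGenFun (halfHilbert f.coeff) (opA f.eval) := by
  have h := f.isGenFun_rieszProj_eval_mul (by norm_num) circleIntegrable_one_div_sqrt_neg
    circleCoeff_one_div_sqrt_neg (h := halfHilbert f.coeff) fun n =>
      hasSum_halfHilbert f.summable_abs n
  simp only [mul_one_div] at h
  exact h

theorem isGenFun_dualRep (g : HardySobolev (3 / 4)) :
    IsGenFun (divSqrtConj g.coeff) (dualRep g) := by
  have h := g.isGenFun_rieszProj_eval_mul (by norm_num) circleIntegrable_one_div_sqrt_one_sub_conj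
    circleCoeff_one_div_sqrt_one_sub_conj (h := divSqrtConj g.coeff) fun n => by
      simpa only [neg_sub] using hasSum_divSqrtConj g.summable_abs n
  simp only [mul_one_div] at h
  exact h

theorem isGenFun_eval (f : HardySobolev (3 / 4)) : IsGenFun f.coeff f.eval := fun z hz =>
  f.hasSum_eval (by norm_num) (by simpa using (mem_ball_zero_iff.1 hz).le)

theorem representsH_divSqrt (f : HardySobolev (3 / 4)) : RepresentsH f (divSqrt f.coeff) := by
  intro z hz
  have hz' : ‖z‖ < 1 := by simpa using hz
  have hb := hasSum_invSqrtCoeff hz'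
  have hf := f.isGenFun_eval z hz
  have h1 := summable_norm_sum_mul_antidiagonal_of_summable_norm hb.summable.norm hf.summable.norm
  have h2 := tsum_mul_tsum_eq_tsum_sum_antidiagonal_of_summable_norm hb.summable.norm
    hf.summable.norm
  rw [hb.tsum_eq, hf.tsum_eq] at h2
  have h3 := h1.of_norm.hasSum
  rw [← h2, one_div_mul_eq_div] at h3
  refine h3.congr_fun fun n => ?_
  rw [divSqrt_eq_coeff, PowerSeries.coeff_mul, Complex.ofReal_sum, sum_mul]
  refine sum_congr rfl fun p hp => ?_
  rw [← mem_antidiagonal.1 hp, pow_add]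
  simp
  ring

theorem representsH_inverseA (g : HardySobolev (3 / 4)) :
    RepresentsH (inverseA g) (divSqrtConj g.coeff) := by
  have h := (inverseA g).representsH_divSqrt
  rwa [inverseA, coeff_ofCoeff, divSqrt_halfHilbertInv] at h

theorem eval_one_inverseA (g : HardySobolev (3 / 4)) : (inverseA g).eval 1 = 0 := by
  rw [eval_one, tsum_coeff_inverseA, Complex.ofReal_zero]

end HardySobolev

/-! ### The isomorphism and the description of `ℋ₀` -/

namespace HardySobolevVanish

open HardySobolev

theorem tsum_coeff (f : HardySobolevVanish) : ∑' m, f.1.coeff m = 0 := by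
  have h : f.1.eval 1 = 0 := f.2
  rw [eval_one] at h
  exact_mod_cast h

/-- The operator `𝒜` from the functions vanishing at `1` to `H²_{3/4}`. -/
def linearA : HardySobolevVanish →ₗ[ℝ] HardySobolev (3 / 4) where
  toFun f := ofCoeff (halfHilbert f.1.coeff)
    (summable_of_sum_range_weight_le (f.1.sum_range_halfHilbert_le (tsum_coeff f)))
  map_add' f g := by
    apply coeff_injective
    ext n
    have h := (hasSum_halfHilbert f.1.summable_abs n).add (hasSum_halfHilbert g.1.summable_abs n)
    refine (hasSum_halfHilbert (f + g).1.summable_abs n).unique (h.congr_fun fun m => ?_)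
    exact add_mul _ _ _
  map_smul' k f := by
    apply coeff_injective
    ext n
    have h := (hasSum_halfHilbert f.1.summable_abs n).mul_left k
    refine (hasSum_halfHilbert (k • f).1.summable_abs n).unique (h.congr_fun fun m => ?_)
    exact mul_assoc _ _ _

theorem coeff_linearA (f : HardySobolevVanish) : (linearA f).coeff = halfHilbert f.1.coeff := rfl

theorem norm_linearA_le (f : HardySobolevVanish) : ‖linearA f‖ ≤ 16 * ‖f‖ :=
  norm_ofCoeff_le (norm_nonneg f) (f.1.sum_range_halfHilbert_le (tsum_coeff f))

theorem linearA_injective : Function.Injective linearA := by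
  rw [← LinearMap.ker_eq_bot, LinearMap.ker_eq_bot']
  intro f hf
  apply Subtype.ext
  apply coeff_injective
  refine eq_zero_of_halfHilbert_eq_zero f.1.summable_abs ?_
  rw [← coeff_linearA, hf, coeff_zero]

theorem linearA_inverseA (g : HardySobolev (3 / 4)) :
    linearA ⟨inverseA g, eval_one_inverseA g⟩ = g :=
  coeff_injective (halfHilbert_inverseA g)

/-- The operator `𝒜` as an isomorphism. -/
def equivA : HardySobolevVanish ≃ₗ[ℝ] HardySobolev (3 / 4) :=
  { linearA with
    invFun := fun g => ⟨inverseA g, eval_one_inverseA g⟩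
    -- Injectivity turns the right inverse into a two-sided one.
    left_inv := fun f => linearA_injective (linearA_inverseA (linearA f))
    right_inv := linearA_inverseA }

theorem inverseA_linearA (f : HardySobolevVanish) : inverseA (linearA f) = f.1 :=
  congrArg Subtype.val (equivA.left_inv f)

/-- The operator `𝒜` as a bounded isomorphism with bounded inverse. -/
def continuousEquivA : HardySobolevVanish ≃L[ℝ] HardySobolev (3 / 4) :=
  equivA.toContinuousLinearEquivOfBounds 16 16 norm_linearA_le fun g => norm_inverseA_le g

end HardySobolevVanish

open HardySobolev HardySobolevVanish in
theorem corollary3p6 :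
    (∃ A : HardySobolevVanish ≃L[ℝ] HardySobolev (3 / 4),
      ∀ f : HardySobolevVanish,
        CircleIntegrable (fun ζ => f.1.eval ζ / Complex.sqrt (-ζ)) 0 1 ∧
        ∀ z ∈ Metric.ball (0 : ℂ) 1, (A f).eval z = opA f.1.eval z) ∧
    (∀ g : HardySobolev (3 / 4),
      CircleIntegrable (fun ζ => g.eval ζ / Complex.sqrt (1 - (starRingEnd ℂ) ζ)) 0 1 ∧
      ∃ h : ℕ → ℝ, IsGenFun h (dualRep g)) ∧
    spaceH0 = {h : ℕ → ℝ | ∃ g : HardySobolev (3 / 4), IsGenFun h (dualRep g)} ∧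
    ∃ C₁ C₂ : ℝ, 0 < C₁ ∧ 0 < C₂ ∧
      ∀ (g : HardySobolev (3 / 4)) (h : ℕ → ℝ), IsGenFun h (dualRep g) →
        C₁ * ‖g‖ ≤ normH h ∧ normH h ≤ C₂ * ‖g‖ := by
  refine ⟨⟨continuousEquivA, fun f => ⟨?_, fun z hz => ?_⟩⟩, fun g => ⟨?_, _, g.isGenFun_dualRep⟩,
    ?_, 1 / 16, 16, by norm_num, by norm_num, fun g h hh => ?_⟩
  · simpa only [mul_one_div] using
      f.1.circleIntegrable_eval_mul (by norm_num) circleIntegrable_one_div_sqrt_neg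
  · exact ((continuousEquivA f).isGenFun_eval z hz).unique (f.1.isGenFun_opA z hz)
  · simpa only [mul_one_div] using
      g.circleIntegrable_eval_mul (by norm_num) circleIntegrable_one_div_sqrt_one_sub_conj
  · ext h
    constructor
    · rintro ⟨f, hf, hf1⟩
      -- The witness is `g = 𝒜 f`; then `𝒜⁻¹ g = f`, and uniqueness of Taylor coefficients
      -- identifies `h`.
      refine ⟨linearA ⟨f, hf1⟩, ?_⟩
      have h1 := representsH_inverseA (linearA ⟨f, hf1⟩)
      rw [inverseA_linearA] at h1
      rw [IsGenFun.unique hf h1]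
      exact isGenFun_dualRep _
    · rintro ⟨g, hg⟩
      rw [hg.unique g.isGenFun_dualRep]
      exact ⟨inverseA g, g.representsH_inverseA, g.eval_one_inverseA⟩
  · rw [hh.unique g.isGenFun_dualRep, normH_eq g.representsH_inverseA]
    refine ⟨?_, g.norm_inverseA_le⟩
    -- The lower bound for `‖h‖_ℋ = ‖𝒜⁻¹ g‖` is the boundedness of `𝒜` applied to `𝒜⁻¹ g`.
    have h1 := norm_linearA_le ⟨inverseA g, g.eval_one_inverseA⟩
    rw [linearA_inverseA] at h1
    have h2 : ‖(⟨inverseA g, g.eval_one_inverseA⟩ : HardySobolevVanish)‖ = ‖inverseA g‖ := rfl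
    rw [h2] at h1
    linarith

end
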